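/- Let $I\subseteq\mathbb R$ be an open interval, $M=\{(t,x,y,z): t\in I,\ (x,y,z)\in\mathbb R^3\}$, and $V\colon M\to\mathbb R$ smooth. For a Lorentzian metric $g$ on $M$ consider the Klein-Gordon equation $$\Delta u-Vu=0,\qquad \Delta u=|g|^{-1/2}\partial_\mu\bigl(|g|^{1/2}g^{\mu\nu}\partial_\nu u\bigr),$$ with Lagrangian $L=\tfrac12|g|^{1/2}g^{\mu\nu}u_\mu u_\nu+\tfrac12|g|^{1/2}Vu^2$. A vector field $X=\xi^\mu(x,u)\partial_\mu+\eta(x,u)\partial_u$ is a Lie symmetry if its second prolongation annihilates $\Delta u-Vu$ at all second jets on which $\Delta u-Vu$ vanishes; it is a Noether symmetry if moreover its first prolongation satisfies $X^{[1]}L+L\,D_\mu\xi^\mu=D_\mu F^\mu$ for some smooth $F^\mu(x,u)$. (1) Let $N,A,B,C$ be smooth nowhere vanishing functions on $I$ and let $g$ be the Bianchi V metric $$ds^2=-N^2(t)\,dt^2+A^2(t)\,dx^2+B^2(t)e^{2x}dy^2+C^2(t)e^{2x}dz^2 .$$ Then $\xi^1=\partial_x-y\partial_y-z\partial_z$, $\xi^2=\partial_y$,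 $\xi^3=\partial_z$ are Killing vectors. Each of the following vector fields is a Lie symmetry if and only if $V$ has the form given, with some smooth function $W$, and it is a Noether symmetry under exactly the same condition: (i) $\xi^1$: $V=W(t,e^xy,e^xz)$; (ii) $\xi^2$: $V=W(t,x,z)$; (iii) $\xi^3$: $V=W(t,x,y)$; (iv) $\alpha\xi^1+\beta\xi^2+\gamma\xi^3$ with real $\alpha\neq0$, $\beta$, $\gamma$: $V=W\bigl(t,(y-\tfrac\beta\alpha)e^x,(z-\tfrac\gamma\alpha)e^x\bigr)$. (2) Let $A$ be a smooth nowhere vanishing function on $I$, let $m\ne0$ and $\lambda$ be real, and let $g$ be the metric $$ds^2=A^2(t)\bigl[e^{m\lambda t}(-dt^2+dx^2)+e^{2x}\bigl(e^{m(\lambda-1)t}dy^2+dz^2\bigr)\bigr].$$ Then $X_3=\tfrac2m\partial_t+y\partial_y+\lambda z\partial_z$ is a conformal Killing vector with conformal factor $\psi=\tfrac2m\tfrac{A_{,t}}{A}+\lambda$, that is $\mathcal L_{X_3}g=2\psi g$. The vector field $X_3-\psi u\,\partial_u$ is a Lie symmetry if and only if it is a Noether symmetry, if and only if $$V=\frac{e^{-m\lambda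 t}}{A^2}\,U\bigl(x,\;ye^{-\frac m2t},\;ze^{-\frac{m\lambda}2t}\bigr)+e^{-m\lambda t}\,\frac{m(\lambda-1)A_{,t}+2A_{,tt}}{2A^3}$$ for some smooth function $U$ on $\mathbb R^3$. For all real $\alpha,\beta,\gamma$ with $\alpha\ne1$ and $\alpha\ne\lambda$, the vector field $X_3+\alpha\xi^1+\beta\xi^2+\gamma\xi^3-\psi u\,\partial_u$ is a Lie symmetry if and only if it is a Noether symmetry, if and only if $$V=\frac{e^{-m\lambda t}}{A^2}\,U\Bigl(x-\tfrac{\alpha m}2t,\;\bigl(y-\tfrac{\beta}{\alpha-1}\bigr)e^{\frac{m(\alpha-1)}2t},\;\bigl(z-\tfrac{\gamma}{\alpha-\lambda}\bigr)e^{\frac{m(\alpha-\lambda)}2t}\Bigr)+e^{-m\lambda t}\,\frac{m(\lambda-1)A_{,t}+2A_{,tt}}{2A^3}$$ for some smooth function $U$ on $\mathbb R^3$. -/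

import Mathlib

open scoped ContDiff

noncomputable section

namespace KleinGordon

/-! Point symmetries of scalar second order equations on an open set of coordinates. -/

abbrev Coord (n : ℕ) := Fin n → ℝ

/-- First jets `(x, u, u_μ)` of functions of `n` variables. -/
abbrev Jet1 (n : ℕ) := Coord n × ℝ × Coord n

/-- Second jets `(x, u, u_μ, u_μν)`; only those with `u_μν = u_νμ` are jets of functions. -/
abbrev Jet2 (n : ℕ) := Coord n × ℝ × Coord n × (Fin n → Fin n → ℝ)

def Jet2.toJet1 {n : ℕ} (j : Jet2 n) : Jet1 n := (j.1, j.2.1, j.2.2.1)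

/-- A vector field `ξ^μ(x,u) ∂_μ + η(x,u) ∂_u`. -/
structure PointField (n : ℕ) where
  ξ : Coord n × ℝ → Coord n
  η : Coord n × ℝ → ℝ

/-- The vector field `ξ^μ(x) ∂_μ + c(x) u ∂_u`. -/
def linearField {n : ℕ} (ξ : Coord n → Coord n) (c : Coord n → ℝ) : PointField n where
  ξ := fun w => ξ w.1
  η := fun w => c w.1 * w.2

/-- The total derivative `D_μ f = f_{,μ} + u_μ f_{,u}` of a function `f(x,u)`. -/
def totalD0 {n : ℕ} (f : Coord n × ℝ → ℝ) (μ : Fin n) (j : Jet1 n) : ℝ :=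
  fderiv ℝ f (j.1, j.2.1) (Pi.single μ 1, j.2.2 μ)

/-- The total derivative `D_ν F = F_{,ν} + u_ν ∂F/∂u + u_νκ ∂F/∂u_κ` of a function
`F(x,u,u_κ)`. -/
def totalD1 {n : ℕ} (F : Jet1 n → ℝ) (ν : Fin n) (j : Jet2 n) : ℝ :=
  fderiv ℝ F j.toJet1 (Pi.single ν 1, j.2.2.1 ν, j.2.2.2 ν)

/-- `η_μ = D_μ η - (D_μ ξ^κ) u_κ`. -/
def prolong1 {n : ℕ} (X : PointField n) (μ : Fin n) (j : Jet1 n) : ℝ :=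
  totalD0 X.η μ j - ∑ κ, totalD0 (fun w => X.ξ w κ) μ j * j.2.2 κ

/-- `η_μν = D_ν η_μ - (D_ν ξ^κ) u_μκ`. -/
def prolong2 {n : ℕ} (X : PointField n) (μ ν : Fin n) (j : Jet2 n) : ℝ :=
  totalD1 (prolong1 X μ) ν j - ∑ κ, totalD0 (fun w => X.ξ w κ) ν j.toJet1 * j.2.2.2 μ κ

/-- `X^[1] L`, the derivative of `L(x,u,u_μ)` along the first prolongation of `X`. -/
def applyProlong1 {n : ℕ} (X : PointField n) (L : Jet1 n → ℝ) (j : Jet1 n) : ℝ :=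
  fderiv ℝ L j (X.ξ (j.1, j.2.1), X.η (j.1, j.2.1), fun μ => prolong1 X μ j)

/-- `X^[2] H`, the derivative of `H(x,u,u_μ,u_μν)` along the second prolongation of `X`. -/
def applyProlong2 {n : ℕ} (X : PointField n) (H : Jet2 n → ℝ) (j : Jet2 n) : ℝ :=
  fderiv ℝ H j (X.ξ (j.1, j.2.1), X.η (j.1, j.2.1),
    fun μ => prolong1 X μ j.toJet1, fun μ ν => prolong2 X μ ν j)

/-- `X` is a Lie point symmetry of the equation `H = 0` over `M`: `X^[2] H = 0` on `H = 0`. -/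
def IsLieSymmetry {n : ℕ} (M : Set (Coord n)) (H : Jet2 n → ℝ) (X : PointField n) : Prop :=
  ∀ j : Jet2 n, j.1 ∈ M → (∀ μ ν, j.2.2.2 μ ν = j.2.2.2 ν μ) → H j = 0 →
    applyProlong2 X H j = 0

/-- `X` is a Noether point symmetry of the equation `H = 0` with Lagrangian `L`: a Lie symmetry
with `X^[1] L + L D_μ ξ^μ = D_μ F^μ` for some smooth `F^μ(x,u)`. -/
def IsNoetherSymmetry {n : ℕ} (M : Set (Coord n)) (H : Jet2 n → ℝ) (L : Jet1 n → ℝ)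
    (X : PointField n) : Prop :=
  IsLieSymmetry M H X ∧
    ∃ F : Coord n × ℝ → Coord n, ContDiffOn ℝ ∞ F (M ×ˢ Set.univ) ∧
      ∀ j : Jet1 n, j.1 ∈ M →
        applyProlong1 X L j + L j * ∑ μ, totalD0 (fun w => X.ξ w μ) μ j
          = ∑ μ, totalD0 (fun w => F w μ) μ j

/-! Metrics in coordinates, conformal Killing vectors, and the Klein-Gordon equation. -/

abbrev MetricField (n : ℕ) := Coord n → Matrix (Fin n) (Fin n) ℝ

/-- The partial derivative `f_{,μ}`. -/
def pd {n : ℕ} (μ : Fin n) (f : Coord n → ℝ) (x : Coord n) : ℝ :=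
  fderiv ℝ f x (Pi.single μ 1)

/-- The components of the Lie derivative of the metric,
`ξ^κ g_{μν,κ} + g_{κν} ξ^κ_{,μ} + g_{μκ} ξ^κ_{,ν}`. -/
def lieMetric {n : ℕ} (g : MetricField n) (ξ : Coord n → Coord n) (μ ν : Fin n)
    (x : Coord n) : ℝ :=
  ∑ κ, (ξ x κ * pd κ (fun y => g y μ ν) x
    + g x κ ν * pd μ (fun y => ξ y κ) x + g x μ κ * pd ν (fun y => ξ y κ) x)

/-- `ξ` is a conformal Killing vector over `M` with conformal factor `ψ`. -/
def IsConformalKilling {n : ℕ} (M : Set (Coord n)) (g : MetricField n) (ξ : Coord n → Coord n)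
    (ψ : Coord n → ℝ) : Prop :=
  ∀ x ∈ M, ∀ μ ν, lieMetric g ξ μ ν x = 2 * ψ x * g x μ ν

def IsKilling {n : ℕ} (M : Set (Coord n)) (g : MetricField n) (ξ : Coord n → Coord n) : Prop :=
  ∀ x ∈ M, ∀ μ ν, lieMetric g ξ μ ν x = 0

/-- `√|det g|`. -/
def volDensity {n : ℕ} (g : MetricField n) (x : Coord n) : ℝ :=
  Real.sqrt |(g x).det|

/-- The first order coefficient `|g|^{-1/2} ∂_μ (|g|^{1/2} g^{μν})` of the Laplacian. -/
def lapCoeff {n : ℕ} (g : MetricField n) (ν : Fin n) (x : Coord n) : ℝ :=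
  (volDensity g x)⁻¹ * ∑ μ, pd μ (fun y => volDensity g y * (g y)⁻¹ μ ν) x

/-- `Δu - V u` as a function on second jets, where
`Δu = |g|^{-1/2} ∂_μ (|g|^{1/2} g^{μν} u_{,ν})`. -/
def kgOperator {n : ℕ} (g : MetricField n) (V : Coord n → ℝ) (j : Jet2 n) : ℝ :=
  (∑ μ, ∑ ν, (g j.1)⁻¹ μ ν * j.2.2.2 μ ν) + (∑ ν, lapCoeff g ν j.1 * j.2.2.1 ν)
    - V j.1 * j.2.1

/-- The Lagrangian `½ |g|^{1/2} g^{μν} u_μ u_ν + ½ |g|^{1/2} V u²`. -/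
def kgLagrangian {n : ℕ} (g : MetricField n) (V : Coord n → ℝ) (j : Jet1 n) : ℝ :=
  1 / 2 * volDensity g j.1 * (∑ μ, ∑ ν, (g j.1)⁻¹ μ ν * j.2.2 μ * j.2.2 ν)
    + 1 / 2 * volDensity g j.1 * V j.1 * j.2.1 ^ 2

/-- `X` is a Lie symmetry of `Δu - V u = 0` over `M`. -/
def KGLie {n : ℕ} (M : Set (Coord n)) (g : MetricField n) (V : Coord n → ℝ)
    (X : PointField n) : Prop :=
  IsLieSymmetry M (kgOperator g V) X

/-- `X` is a Noether symmetry of `Δu - V u = 0` over `M`. -/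
def KGNoether {n : ℕ} (M : Set (Coord n)) (g : MetricField n) (V : Coord n → ℝ)
    (X : PointField n) : Prop :=
  IsNoetherSymmetry M (kgOperator g V) (kgLagrangian g V) X

/-! Bianchi V spacetimes, in coordinates `(t, x, y, z) = (p 0, p 1, p 2, p 3)`. -/

/-- The coordinate domain `t ∈ I`, `(x,y,z) ∈ ℝ³`. -/
def slab (I : Set ℝ) : Set (Coord 4) := {p | p 0 ∈ I}

/-- `-N² dt² + A² dx² + B² (e^x dy)² + C² (e^x dz)²`. -/
def bianchiV (N A B C : ℝ → ℝ) : MetricField 4 := fun p =>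
  Matrix.diagonal ![-(N (p 0)) ^ 2, (A (p 0)) ^ 2, (B (p 0)) ^ 2 * Real.exp (p 1) ^ 2,
    (C (p 0)) ^ 2 * Real.exp (p 1) ^ 2]

/-- `∂_x - y ∂_y - z ∂_z`. -/
def kv1 (p : Coord 4) : Coord 4 := ![0, 1, -p 2, -p 3]

/-- `∂_y`. -/
def kv2 (_ : Coord 4) : Coord 4 := ![0, 0, 1, 0]

/-- `∂_z`. -/
def kv3 (_ : Coord 4) : Coord 4 := ![0, 0, 0, 1]

/-- `A² [e^{mlt} (-dt² + dx²) + e^{2x} (e^{m(l-1)t} dy² + dz²)]`. -/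
def bianchiVConf (A : ℝ → ℝ) (m l : ℝ) : MetricField 4 := fun p =>
  Matrix.diagonal ![-((A (p 0)) ^ 2 * Real.exp (m * l * p 0)),
    (A (p 0)) ^ 2 * Real.exp (m * l * p 0),
    (A (p 0)) ^ 2 * (Real.exp (2 * p 1) * Real.exp (m * (l - 1) * p 0)),
    (A (p 0)) ^ 2 * Real.exp (2 * p 1)]

/-- `X₃ = (2/m) ∂_t + y ∂_y + l z ∂_z`. -/
def ckv3 (m l : ℝ) (p : Coord 4) : Coord 4 := ![2 / m, 0, p 2, l * p 3]

/-- The conformal factor `(2/m) A_{,t}/A + l` of `X₃`. -/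
def ckv3Factor (A : ℝ → ℝ) (m l : ℝ) (p : Coord 4) : ℝ :=
  2 / m * (deriv A (p 0) / A (p 0)) + l

/-! The potentials. -/

/-- `V = W(t, e^x y, e^x z)`. -/
def PotI (I : Set ℝ) (V : Coord 4 → ℝ) : Prop :=
  ∃ W : ℝ × ℝ × ℝ → ℝ, ContDiffOn ℝ ∞ W (I ×ˢ Set.univ) ∧
    ∀ t ∈ I, ∀ x y z : ℝ, V ![t, x, y, z] = W (t, Real.exp x * y, Real.exp x * z)

/-- `V = W(t, x, z)`. -/
def PotII (I : Set ℝ) (V : Coord 4 → ℝ) : Prop :=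
  ∃ W : ℝ × ℝ × ℝ → ℝ, ContDiffOn ℝ ∞ W (I ×ˢ Set.univ) ∧
    ∀ t ∈ I, ∀ x y z : ℝ, V ![t, x, y, z] = W (t, x, z)

/-- `V = W(t, x, y)`. -/
def PotIII (I : Set ℝ) (V : Coord 4 → ℝ) : Prop :=
  ∃ W : ℝ × ℝ × ℝ → ℝ, ContDiffOn ℝ ∞ W (I ×ˢ Set.univ) ∧
    ∀ t ∈ I, ∀ x y z : ℝ, V ![t, x, y, z] = W (t, x, y)

/-- `V = W(t, (y - β/α) e^x, (z - γ/α) e^x)`. -/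
def PotIV (I : Set ℝ) (α β γ : ℝ) (V : Coord 4 → ℝ) : Prop :=
  ∃ W : ℝ × ℝ × ℝ → ℝ, ContDiffOn ℝ ∞ W (I ×ˢ Set.univ) ∧
    ∀ t ∈ I, ∀ x y z : ℝ, V ![t, x, y, z]
      = W (t, (y - β / α) * Real.exp x, (z - γ / α) * Real.exp x)

/-- The particular term `e^{-mlt} (m (l-1) A_{,t} + 2 A_{,tt}) / (2 A³)`. -/
def potTerm (A : ℝ → ℝ) (m l t : ℝ) : ℝ :=
  Real.exp (-(m * l * t)) *
    ((m * (l - 1) * deriv A t + 2 * deriv (deriv A) t) / (2 * A t ^ 3))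

/-- `V = A⁻² e^{-mlt} U(x, y e^{-mt/2}, z e^{-mlt/2}) + potTerm`. -/
def PotConf (I : Set ℝ) (A : ℝ → ℝ) (m l : ℝ) (V : Coord 4 → ℝ) : Prop :=
  ∃ U : ℝ × ℝ × ℝ → ℝ, ContDiff ℝ ∞ U ∧
    ∀ t ∈ I, ∀ x y z : ℝ, V ![t, x, y, z]
      = 1 / A t ^ 2 * Real.exp (-(m * l * t)) *
          U (x, y * Real.exp (-(m / 2 * t)), z * Real.exp (-(m * l / 2 * t)))
        + potTerm A m l t

/-- `V = A⁻² e^{-mlt} U(x - (αm/2) t, (y - β/(α-1)) e^{m(α-1)t/2}, (z - γ/(α-l)) e^{m(α-l)t/2})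
+ potTerm`. -/
def PotV (I : Set ℝ) (A : ℝ → ℝ) (m l α β γ : ℝ) (V : Coord 4 → ℝ) : Prop :=
  ∃ U : ℝ × ℝ × ℝ → ℝ, ContDiff ℝ ∞ U ∧
    ∀ t ∈ I, ∀ x y z : ℝ, V ![t, x, y, z]
      = 1 / A t ^ 2 * Real.exp (-(m * l * t)) *
          U (x - α * m / 2 * t,
            (y - β / (α - 1)) * Real.exp (m * (α - 1) / 2 * t),
            (z - γ / (α - l)) * Real.exp (m * (α - l) / 2 * t))
        + potTerm A m l t

end KleinGordon

end

/-! Both parts are one computation. The metrics are diagonal with entries `d i`, and every field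
that occurs is affine with components `a i + b i * x i`, so the conformal Killing equation reduces
to `ξ(d i) = 2 (ψ - b i) d i`. For `X = ξ + c u ∂_u` with `2c = (2 - n)ψ`, the second prolongation
gives (`applyProlong2_kgOperator`) X^[2] H = (c - 2ψ) H + u (Δc - ξ(V) - 2ψV), where H = Δu - Vu.
Hence `X` is a Lie symmetry exactly when `ξ(V) + 2ψV = Δc` (`kgLie_diagMetric_iff`). The same
equation makes X^[1] L + L D_μ ξ^μ the divergence of ½ |g|^{1/2} g^{μν} c_{,ν} u², so it also
characterizes Noether symmetries (`kgNoether_diagMetric_iff`).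

It remains to solve a linear first order equation for `V` by characteristics. For Killing fields ψ =
c = 0, and `V` is constant along a complete flow that fixes `t`; its values on a slice such as `x =
0` give `W`. For fields containing `X₃`, n = 4 and c = -ψ, and `t` itself parametrizes the orbits.
The weight `w = A² e^{mλt}` satisfies `w' = mψw` and is an integrating factor, while `(m/2) w Δ(-ψ)`
is the derivative of `v = potSource` (`diagLap_ckv3Factor`). So `wV - v` is constant along orbits
(`weighted_fderiv_eq_iff`). Each orbit meets a slice `t = t₀` exactly once and that slice is all of
ℝ³, which gives a smooth `U` on ℝ³. -/

noncomputable section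

namespace KleinGordon

/-! ### Diagonal metrics and affine conformal fields in `n` dimensions -/

section General

variable {n : ℕ}

/-- The metric `∑ dᵢ (dxⁱ)²`. -/
def diagMetric (d : Fin n → Coord n → ℝ) : MetricField n :=
  fun x => Matrix.diagonal fun i => d i x

/-- The vector field with components `aᵢ + bᵢ xⁱ`. -/
def affineField (a b : Fin n → ℝ) (x : Coord n) : Coord n := fun i => a i + b i * x i

/-- `|g|^{-1/2} ∂_ν (|g|^{1/2} / d_ν)`. -/
def diagLapCoeff (d : Fin n → Coord n → ℝ) (ν : Fin n) (x : Coord n) : ℝ :=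
  (volDensity (diagMetric d) x)⁻¹ *
    pd ν (fun y => volDensity (diagMetric d) y * (d ν y)⁻¹) x

/-- The Laplacian of a function in a diagonal metric. -/
def diagLap (d : Fin n → Coord n → ℝ) (c : Coord n → ℝ) (x : Coord n) : ℝ :=
  ∑ μ, ((d μ x)⁻¹ * pd μ (pd μ c) x + diagLapCoeff d μ x * pd μ c x)

theorem sum_mul_pd (f : Coord n → ℝ) (v x : Coord n) :
    ∑ κ, v κ * pd κ f x = fderiv ℝ f x v := by
  conv_rhs => rw [pi_eq_sum_univ' v, map_sum]
  refine Finset.sum_congr rfl fun κ _ => ?_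
  rw [map_smul, smul_eq_mul, pd]

theorem hasFDerivAt_affineField_apply (a b : Fin n → ℝ) (x : Coord n) (κ : Fin n) :
    HasFDerivAt (fun y => affineField a b y κ)
      (b κ • ContinuousLinearMap.proj (R := ℝ) (φ := fun _ : Fin n => ℝ) κ) x :=
  ((hasFDerivAt_apply κ x).const_mul (b κ)).const_add (a κ)

theorem hasFDerivAt_affineField (a b : Fin n → ℝ) (x : Coord n) :
    HasFDerivAt (affineField a b)
      (ContinuousLinearMap.pi fun κ =>
        b κ • ContinuousLinearMap.proj (R := ℝ) (φ := fun _ : Fin n => ℝ) κ) x :=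
  hasFDerivAt_pi.2 fun κ => hasFDerivAt_affineField_apply a b x κ

theorem pd_affineField (a b : Fin n → ℝ) (x : Coord n) (μ κ : Fin n) :
    pd μ (fun y => affineField a b y κ) x = if κ = μ then b μ else 0 := by
  rw [pd, (hasFDerivAt_affineField_apply a b x κ).fderiv]
  by_cases h : κ = μ
  · subst h; simp
  · simp [h]

/-- The component `ξ^κ` depends on `x^κ` alone, so no off-diagonal terms arise. The diagonal ones
turn the conformal Killing equation into the condition `hξ` used throughout. -/
theorem lieMetric_diagMetric (d : Fin n → Coord n → ℝ) (a b : Fin n → ℝ) (μ ν : Fin n)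
    (x : Coord n) :
    lieMetric (diagMetric d) (affineField a b) μ ν x
      = if μ = ν then fderiv ℝ (d μ) x (affineField a b x) + 2 * b μ * d μ x else 0 := by
  unfold lieMetric
  simp only [Finset.sum_add_distrib, pd_affineField, sum_mul_pd]
  by_cases h : μ = ν
  · subst h
    simp [diagMetric]
    ring
  · simp [diagMetric, h]

/-! Commuting a diagonal affine field with a partial derivative. -/

theorem contDiffAt_pd {f : Coord n → ℝ} {x : Coord n} (hf : ContDiffAt ℝ ∞ f x) (ν : Fin n) :
    ContDiffAt ℝ ∞ (pd ν f) x :=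
  (hf.fderiv_right (m := ∞) (by simp)).clm_apply contDiffAt_const

/-- This is the bracket `[ξ, ∂_ν] = -b_ν ∂_ν`, obtained from the symmetry of the second derivative.
-/
theorem fderiv_pd_affineField {f : Coord n → ℝ} {x : Coord n} (hf : ContDiffAt ℝ ∞ f x)
    (a b : Fin n → ℝ) (ν : Fin n) :
    fderiv ℝ (pd ν f) x (affineField a b x)
      = pd ν (fun y => fderiv ℝ f y (affineField a b y)) x - b ν * pd ν f x := by
  have h2 : DifferentiableAt ℝ (fderiv ℝ f) x :=
    (hf.fderiv_right (m := ∞) (by simp)).differentiableAt (by simp)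
  have hs : IsSymmSndFDerivAt ℝ f x := hf.isSymmSndFDerivAt (by
    rw [minSmoothness_of_isRCLikeNormedField]; exact WithTop.coe_le_coe.2 le_top)
  have e1 : HasFDerivAt (pd ν f) _ x := h2.hasFDerivAt.clm_apply (hasFDerivAt_const _ x)
  have e2 := h2.hasFDerivAt.clm_apply (hasFDerivAt_affineField a b x)
  rw [e1.fderiv, pd, e2.fderiv]
  have e3 : (ContinuousLinearMap.pi fun κ => b κ •
      ContinuousLinearMap.proj (R := ℝ) (φ := fun _ : Fin n => ℝ) κ) (Pi.single ν 1)
        = b ν • Pi.single ν (1 : ℝ) := by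
    ext i
    by_cases h : i = ν
    · subst h; simp
    · simp [h]
  simp only [add_apply, ContinuousLinearMap.comp_apply,
    ContinuousLinearMap.flip_apply, e3, map_smul, smul_eq_mul, pd]
  rw [hs.eq]
  simp

/-! Diagonal metrics with a diagonal affine conformal Killing field. -/

section Diagonal

variable {M : Set (Coord n)} {d : Fin n → Coord n → ℝ} {a b : Fin n → ℝ} {ψ c V : Coord n → ℝ}

theorem volDensity_diagMetric (d : Fin n → Coord n → ℝ) (x : Coord n) :
    volDensity (diagMetric d) x = Real.sqrt |∏ i, d i x| := by
  simp [volDensity, diagMetric]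

theorem diagMetric_inv {x : Coord n} (h0 : ∀ i, d i x ≠ 0) (μ ν : Fin n) :
    (diagMetric d x)⁻¹ μ ν = if μ = ν then (d μ x)⁻¹ else 0 := by
  have h : (diagMetric d x)⁻¹ = Matrix.diagonal fun i => (d i x)⁻¹ := by
    apply Matrix.inv_eq_right_inv
    rw [diagMetric, Matrix.diagonal_mul_diagonal]
    simp [h0]
  rw [h, Matrix.diagonal_apply]

theorem lapCoeff_diagMetric (hM : IsOpen M) (h0 : ∀ i, ∀ x ∈ M, d i x ≠ 0) {x : Coord n}
    (hx : x ∈ M) (ν : Fin n) : lapCoeff (diagMetric d) ν x = diagLapCoeff d ν x := by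
  unfold lapCoeff diagLapCoeff
  congr 1
  have key : ∀ μ, pd μ (fun y => volDensity (diagMetric d) y * (diagMetric d y)⁻¹ μ ν) x
      = if μ = ν then pd ν (fun y => volDensity (diagMetric d) y * (d ν y)⁻¹) x else 0 := by
    intro μ
    have : (fun y => volDensity (diagMetric d) y * (diagMetric d y)⁻¹ μ ν) =ᶠ[nhds x]
        fun y => if μ = ν then volDensity (diagMetric d) y * (d ν y)⁻¹ else 0 := by
      filter_upwards [hM.mem_nhds hx] with y hy
      rw [diagMetric_inv fun i => h0 i y hy]
      split_ifs with h
      · rw [h]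
      · simp
    rw [pd, this.fderiv_eq]
    split_ifs with h
    · rw [h, pd]
    · simp
  simp [key]

theorem kgOperator_diagMetric (hM : IsOpen M) (h0 : ∀ i, ∀ x ∈ M, d i x ≠ 0) {j : Jet2 n}
    (hj : j.1 ∈ M) :
    kgOperator (diagMetric d) V j
      = ∑ μ, ((d μ j.1)⁻¹ * j.2.2.2 μ μ + diagLapCoeff d μ j.1 * j.2.2.1 μ) - V j.1 * j.2.1 := by
  unfold kgOperator
  simp only [diagMetric_inv fun i => h0 i j.1 hj, lapCoeff_diagMetric hM h0 hj, ite_mul, zero_mul,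
    Finset.sum_ite_eq, Finset.mem_univ, if_true, Finset.sum_add_distrib]

theorem kgLagrangian_diagMetric (h0 : ∀ i, ∀ x ∈ M, d i x ≠ 0) {j : Jet1 n} (hj : j.1 ∈ M) :
    kgLagrangian (diagMetric d) V j
      = 1 / 2 * volDensity (diagMetric d) j.1 *
          (∑ μ, (d μ j.1)⁻¹ * j.2.2 μ ^ 2 + V j.1 * j.2.1 ^ 2) := by
  unfold kgLagrangian
  simp only [diagMetric_inv fun i => h0 i j.1 hj, ite_mul, zero_mul,
    Finset.sum_ite_eq, Finset.mem_univ, if_true, mul_assoc, ← pow_two]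
  ring

theorem volDensity_pos (h0 : ∀ i, ∀ x ∈ M, d i x ≠ 0) {x : Coord n} (hx : x ∈ M) :
    0 < volDensity (diagMetric d) x := by
  rw [volDensity_diagMetric]
  exact Real.sqrt_pos.2 (abs_pos.2 (Finset.prod_ne_zero_iff.2 fun i _ => h0 i x hx))

theorem contDiffAt_volDensity {x : Coord n} (hd : ∀ i, ContDiffAt ℝ ∞ (d i) x)
    (h0 : ∀ i, d i x ≠ 0) : ContDiffAt ℝ ∞ (volDensity (diagMetric d)) x := by
  have e : volDensity (diagMetric d) = fun x => Real.sqrt |∏ i, d i x| :=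
    funext (volDensity_diagMetric d)
  rw [e]
  have hp : ∏ i, d i x ≠ 0 := Finset.prod_ne_zero_iff.2 fun i _ => h0 i
  have h : ContDiffAt ℝ ∞ (fun y => |∏ i, d i y|) x :=
    (contDiffAt_abs hp).comp x (f := fun y => ∏ i, d i y) (contDiffAt_prod fun i _ => hd i)
  exact h.sqrt (abs_ne_zero.2 hp)

theorem fderiv_volDensity {x : Coord n} (hd : ∀ i, ContDiffAt ℝ ∞ (d i) x)
    (h0 : ∀ i, d i x ≠ 0) (v : Coord n) (k : Fin n → ℝ)
    (hk : ∀ i, fderiv ℝ (d i) x v = 2 * k i * d i x) :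
    fderiv ℝ (volDensity (diagMetric d)) x v = (∑ i, k i) * volDensity (diagMetric d) x := by
  have hp : ∏ i, d i x ≠ 0 := Finset.prod_ne_zero_iff.2 fun i _ => h0 i
  have h1 : HasFDerivAt (fun y => ∏ i, d i y) _ x :=
    HasFDerivAt.finsetProd fun i (_ : i ∈ Finset.univ) =>
      ((hd i).differentiableAt (by simp)).hasFDerivAt
  have hv : fderiv ℝ (fun y => ∏ i, d i y) x v = (2 * ∑ i, k i) * ∏ i, d i x := by
    rw [h1.fderiv]
    simp only [sum_apply, smul_apply, smul_eq_mul, hk]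
    rw [Finset.mul_sum, Finset.sum_mul]
    refine Finset.sum_congr rfl fun i _ => ?_
    rw [← Finset.mul_prod_erase Finset.univ (fun i => d i x) (Finset.mem_univ i)]
    ring
  have hV := contDiffAt_volDensity hd h0
  have hV' := hV.differentiableAt (by simp)
  have hpos : 0 < volDensity (diagMetric d) x :=  by
    rw [volDensity_diagMetric]; exact Real.sqrt_pos.2 (abs_pos.2 hp)
  -- Fourth powers remove both the square root and the absolute value. Differentiating this
  -- polynomial identity and cancelling `ρ³ > 0`, with `ρ` the density, gives the claim.
  have e4 : (fun y => volDensity (diagMetric d) y ^ 4) = fun y => (∏ i, d i y) ^ 2 := by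
    funext y
    rw [volDensity_diagMetric, show 4 = 2 * 2 from rfl, pow_mul,
      Real.sq_sqrt (abs_nonneg _), sq_abs]
  have e5 := congrArg (fun f => fderiv ℝ f x v) e4
  have h2 := (hV'.hasFDerivAt.pow 4).fderiv
  have h3 := (h1.differentiableAt.hasFDerivAt.pow 2).fderiv
  beta_reduce at h2 h3 e5
  rw [h2, h3] at e5
  simp only [smul_apply, smul_eq_mul, hv] at e5
  have e6 := congrFun e4 x
  beta_reduce at e6
  have : volDensity (diagMetric d) x ^ 3 * (fderiv ℝ (volDensity (diagMetric d)) x v)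
      = volDensity (diagMetric d) x ^ 3 * ((∑ i, k i) * volDensity (diagMetric d) x) := by
    norm_num at e5
    linear_combination (1 / 4) * e5 - (∑ i, k i) * e6
  exact mul_left_cancel₀ (by positivity) this

theorem contDiffAt_density_inv {x : Coord n} (hd : ∀ i, ContDiffAt ℝ ∞ (d i) x)
    (h0 : ∀ i, d i x ≠ 0) (ν : Fin n) :
    ContDiffAt ℝ ∞ (fun y => volDensity (diagMetric d) y * (d ν y)⁻¹) x :=
  (contDiffAt_volDensity hd h0).mul ((hd ν).inv (h0 ν))

theorem contDiffAt_diagLapCoeff {x : Coord n} (hd : ∀ i, ContDiffAt ℝ ∞ (d i) x)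
    (h0 : ∀ i, d i x ≠ 0) (ν : Fin n) : ContDiffAt ℝ ∞ (diagLapCoeff d ν) x := by
  refine ((contDiffAt_volDensity hd h0).inv ?_).mul
    (contDiffAt_pd (contDiffAt_density_inv hd h0 ν) ν)
  exact (volDensity_pos (M := {x}) (fun i y hy => by rw [hy]; exact h0 i) rfl).ne'

theorem fderiv_inv_apply {f : Coord n → ℝ} {x : Coord n} (hf : DifferentiableAt ℝ f x)
    (h0 : f x ≠ 0) (v : Coord n) :
    fderiv ℝ (fun y => (f y)⁻¹) x v = -(f x ^ 2)⁻¹ * fderiv ℝ f x v := by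
  have h := ((hasDerivAt_inv h0).comp_hasFDerivAt x hf.hasFDerivAt).fderiv
  have h' := congrArg (fun L => L v) h
  simpa [Function.comp_def] using h'

theorem fderiv_mul_apply {E : Type*} [NormedAddCommGroup E] [NormedSpace ℝ E] {f g : E → ℝ} {x : E}
    (hf : DifferentiableAt ℝ f x) (hg : DifferentiableAt ℝ g x) (v : E) :
    fderiv ℝ (fun y => f y * g y) x v = fderiv ℝ f x v * g x + f x * fderiv ℝ g x v := by
  rw [fderiv_fun_mul hf hg]
  simp
  ring

theorem fderiv_inv_diag (hM : IsOpen M) (hd : ∀ i, ContDiffOn ℝ ∞ (d i) M)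
    (h0 : ∀ i, ∀ x ∈ M, d i x ≠ 0)
    (hξ : ∀ i, ∀ x ∈ M, fderiv ℝ (d i) x (affineField a b x) = 2 * (ψ x - b i) * d i x)
    {x : Coord n} (hx : x ∈ M) (ν : Fin n) :
    fderiv ℝ (fun y => (d ν y)⁻¹) x (affineField a b x) = 2 * (b ν - ψ x) * (d ν x)⁻¹ := by
  have h := h0 ν x hx
  rw [fderiv_inv_apply (((hd ν).contDiffAt (hM.mem_nhds hx)).differentiableAt (by simp)) h,
    hξ ν x hx]
  field_simp
  ring

theorem fderiv_density (hM : IsOpen M) (hd : ∀ i, ContDiffOn ℝ ∞ (d i) M)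
    (h0 : ∀ i, ∀ x ∈ M, d i x ≠ 0)
    (hξ : ∀ i, ∀ x ∈ M, fderiv ℝ (d i) x (affineField a b x) = 2 * (ψ x - b i) * d i x)
    {x : Coord n} (hx : x ∈ M) :
    fderiv ℝ (volDensity (diagMetric d)) x (affineField a b x)
      = (n * ψ x - ∑ i, b i) * volDensity (diagMetric d) x := by
  rw [fderiv_volDensity (fun i => (hd i).contDiffAt (hM.mem_nhds hx)) (fun i => h0 i x hx)
    (affineField a b x) (fun i => ψ x - b i) fun i => hξ i x hx]
  simp

/-- The product `R = |g|^{1/2} / d_ν` is only rescaled by `ξ`, with factor `(n - 2)ψ - ∑ b + 2 b_ν`.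
Commuting `ξ` past `∂_ν` leaves one inhomogeneous term, from the derivative of `ψ`. It is this term
that dictates `2c = (2 - n)ψ`. -/
theorem fderiv_diagLapCoeff (hM : IsOpen M) (hd : ∀ i, ContDiffOn ℝ ∞ (d i) M)
    (h0 : ∀ i, ∀ x ∈ M, d i x ≠ 0) (hψ : ContDiffOn ℝ ∞ ψ M)
    (hξ : ∀ i, ∀ x ∈ M, fderiv ℝ (d i) x (affineField a b x) = 2 * (ψ x - b i) * d i x)
    {x : Coord n} (hx : x ∈ M) (ν : Fin n) :
    fderiv ℝ (diagLapCoeff d ν) x (affineField a b x)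
      = (b ν - 2 * ψ x) * diagLapCoeff d ν x + (n - 2) * pd ν ψ x * (d ν x)⁻¹ := by
  have hd' : ∀ {y}, y ∈ M → ∀ i, ContDiffAt ℝ ∞ (d i) y :=
    fun hy i => (hd i).contDiffAt (hM.mem_nhds hy)
  have hρ := (contDiffAt_volDensity (hd' hx) fun i => h0 i x hx)
  have hρ0 := (volDensity_pos h0 hx).ne'
  set R : Coord n → ℝ := fun y => volDensity (diagMetric d) y * (d ν y)⁻¹ with hR
  have hRs : ContDiffAt ℝ ∞ R x := contDiffAt_density_inv (hd' hx) (fun i => h0 i x hx) ν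
  have hRξ : (fun y => fderiv ℝ R y (affineField a b y))
      =ᶠ[nhds x] fun y => ((n - 2) * ψ y - ∑ i, b i + 2 * b ν) * R y := by
    filter_upwards [hM.mem_nhds hx] with y hy
    rw [hR, fderiv_mul_apply (g := fun y => (d ν y)⁻¹) ((contDiffAt_volDensity (hd' hy)
      fun i => h0 i y hy).differentiableAt (by simp))
      (((hd' hy ν).inv (h0 ν y hy)).differentiableAt (by simp)),
      fderiv_density hM hd h0 hξ hy, fderiv_inv_diag hM hd h0 hξ hy]
    ring
  have hψ' : DifferentiableAt ℝ ψ x :=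
    (hψ.contDiffAt (hM.mem_nhds hx)).differentiableAt (by simp)
  have e1 : pd ν (fun y => fderiv ℝ R y (affineField a b y)) x
      = (n - 2) * pd ν ψ x * R x + ((n - 2) * ψ x - ∑ i, b i + 2 * b ν) * pd ν R x := by
    rw [pd, hRξ.fderiv_eq, fderiv_mul_apply (by fun_prop) (hRs.differentiableAt (by simp))]
    congr 2
    rw [fderiv_add_const, fderiv_sub_const, fderiv_const_mul hψ']
    rfl
  have e2 := fderiv_pd_affineField hRs a b ν
  rw [e1] at e2
  have e3 : diagLapCoeff d ν = fun y => (volDensity (diagMetric d) y)⁻¹ * pd ν R y := rfl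
  rw [e3, fderiv_mul_apply (f := fun y => (volDensity (diagMetric d) y)⁻¹)
    ((hρ.inv hρ0).differentiableAt (by simp))
    ((contDiffAt_pd hRs ν).differentiableAt (by simp)),
    fderiv_inv_apply (hρ.differentiableAt (by simp)) hρ0, e2, fderiv_density hM hd h0 hξ hx]
  simp only [hR]
  field_simp
  ring

/-! Prolongations of `ξ + c u ∂_u` with `ξ` diagonal affine. -/

theorem hasFDerivAt_fst {E : Type*} [NormedAddCommGroup E] [NormedSpace ℝ E] {f : Coord n → ℝ}
    {j : Coord n × E} (hf : DifferentiableAt ℝ f j.1) :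
    HasFDerivAt (fun w : Coord n × E => f w.1)
      ((fderiv ℝ f j.1).comp (ContinuousLinearMap.fst ℝ _ _)) j :=
  hf.hasFDerivAt.comp j (ContinuousLinearMap.fst ℝ (Coord n) E).hasFDerivAt

theorem hasFDerivAt_jet_value {E : Type*} [NormedAddCommGroup E] [NormedSpace ℝ E]
    (j : Coord n × ℝ × E) :
    HasFDerivAt (fun k : Coord n × ℝ × E => k.2.1)
      ((ContinuousLinearMap.fst ℝ ℝ E).comp (ContinuousLinearMap.snd ℝ (Coord n) (ℝ × E))) j :=
  ((ContinuousLinearMap.fst ℝ ℝ E).comp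
    (ContinuousLinearMap.snd ℝ (Coord n) (ℝ × E))).hasFDerivAt

theorem totalD0_mul_snd {j : Jet1 n} (hc : DifferentiableAt ℝ c j.1) (μ : Fin n) :
    totalD0 (fun w => c w.1 * w.2) μ j = pd μ c j.1 * j.2.1 + c j.1 * j.2.2 μ := by
  have h := (hasFDerivAt_fst (j := (j.1, j.2.1)) hc)
  rw [totalD0, fderiv_mul_apply h.differentiableAt differentiableAt_snd, h.fderiv, fderiv_snd]
  simp [pd]

theorem totalD0_affineField (j : Jet1 n) (μ κ : Fin n) :
    totalD0 (fun w : Coord n × ℝ => affineField a b w.1 κ) μ j = if κ = μ then b μ else 0 := by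
  rw [totalD0, (hasFDerivAt_fst (j := (j.1, j.2.1))
    (hasFDerivAt_affineField_apply a b j.1 κ).differentiableAt).fderiv,
    ← pd_affineField a b j.1 μ κ]
  rfl

theorem prolong1_linearField {j : Jet1 n} (hc : DifferentiableAt ℝ c j.1) (μ : Fin n) :
    prolong1 (linearField (affineField a b) c) μ j
      = pd μ c j.1 * j.2.1 + (c j.1 - b μ) * j.2.2 μ := by
  unfold prolong1
  simp only [linearField, totalD0_mul_snd hc, totalD0_affineField]
  simp
  ring

theorem prolong2_linearField (hM : IsOpen M) (hc : ContDiffOn ℝ ∞ c M) {j : Jet2 n}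
    (hj : j.1 ∈ M) (μ : Fin n) :
    prolong2 (linearField (affineField a b) c) μ μ j
      = pd μ (pd μ c) j.1 * j.2.1 + 2 * pd μ c j.1 * j.2.2.1 μ
        + (c j.1 - 2 * b μ) * j.2.2.2 μ μ := by
  have hcj := hc.contDiffAt (hM.mem_nhds hj)
  have hcd : DifferentiableAt ℝ c j.1 := hcj.differentiableAt (by simp)
  have hpd : DifferentiableAt ℝ (pd μ c) j.1 := (contDiffAt_pd hcj μ).differentiableAt (by simp)
  have e : prolong1 (linearField (affineField a b) c) μ =ᶠ[nhds j.toJet1]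
      fun k => pd μ c k.1 * k.2.1 + (c k.1 - b μ) * k.2.2 μ := by
    filter_upwards [continuous_fst.continuousAt.preimage_mem_nhds (hM.mem_nhds hj)] with k hk
    exact prolong1_linearField ((hc.contDiffAt (hM.mem_nhds hk)).differentiableAt (by simp)) μ
  have h1 := hasFDerivAt_fst (j := j.toJet1) hpd
  have h2 := (hasFDerivAt_fst (j := j.toJet1) hcd).sub_const (b μ)
  have h3 := hasFDerivAt_jet_value j.toJet1
  have h4 := hasFDerivAt_pi'.1 (hasFDerivAt_snd (𝕜 := ℝ) (p := j.toJet1)).snd μ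
  unfold prolong2 totalD1
  rw [e.fderiv_eq, ((h1.fun_mul h3).fun_add (h2.fun_mul h4)).fderiv]
  simp only [linearField, totalD0_affineField]
  simp [Jet2.toJet1]
  simp only [pd]
  ring

theorem hasFDerivAt_jet_slope {E : Type*} [NormedAddCommGroup E] [NormedSpace ℝ E]
    (j : Coord n × ℝ × Coord n × E) (μ : Fin n) :
    HasFDerivAt (fun k : Coord n × ℝ × Coord n × E => k.2.2.1 μ)
      ((ContinuousLinearMap.proj (R := ℝ) (φ := fun _ : Fin n => ℝ) μ).comp
        ((ContinuousLinearMap.fst ℝ (Coord n) E).comp ((ContinuousLinearMap.snd ℝ ℝ _).comp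
          (ContinuousLinearMap.snd ℝ (Coord n) _)))) j :=
  hasFDerivAt_pi'.1 (hasFDerivAt_snd (𝕜 := ℝ) (p := j)).snd.fst μ

theorem hasFDerivAt_jet_hessian (j : Jet2 n) (μ : Fin n) :
    HasFDerivAt (fun k : Jet2 n => k.2.2.2 μ μ)
      ((ContinuousLinearMap.proj (R := ℝ) (φ := fun _ : Fin n => ℝ) μ).comp
        ((ContinuousLinearMap.proj (R := ℝ) (φ := fun _ : Fin n => Fin n → ℝ) μ).comp
          ((ContinuousLinearMap.snd ℝ (Coord n) _).comp ((ContinuousLinearMap.snd ℝ ℝ _).comp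
            (ContinuousLinearMap.snd ℝ (Coord n) _))))) j :=
  hasFDerivAt_pi'.1 (hasFDerivAt_pi'.1 (hasFDerivAt_snd (𝕜 := ℝ) (p := j)).snd.snd μ) μ

/-- The second prolongation of `ξ + c u ∂_u` acting on the Klein-Gordon operator. -/
theorem applyProlong2_kgOperator (hM : IsOpen M) (hd : ∀ i, ContDiffOn ℝ ∞ (d i) M)
    (h0 : ∀ i, ∀ x ∈ M, d i x ≠ 0) (hψ : ContDiffOn ℝ ∞ ψ M) (hc : ContDiffOn ℝ ∞ c M)
    (hV : ContDiffOn ℝ ∞ V M)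
    (hξ : ∀ i, ∀ x ∈ M, fderiv ℝ (d i) x (affineField a b x) = 2 * (ψ x - b i) * d i x)
    (hcψ : ∀ x ∈ M, 2 * c x = (2 - n) * ψ x) {j : Jet2 n} (hj : j.1 ∈ M) :
    applyProlong2 (linearField (affineField a b) c) (kgOperator (diagMetric d) V) j
      = (c j.1 - 2 * ψ j.1) * kgOperator (diagMetric d) V j
        + j.2.1 * (diagLap d c j.1 - fderiv ℝ V j.1 (affineField a b j.1)
          - 2 * ψ j.1 * V j.1) := by
  have hn := hM.mem_nhds hj
  have hcd : DifferentiableAt ℝ c j.1 := (hc.contDiffAt hn).differentiableAt (by simp)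
  have e : kgOperator (diagMetric d) V =ᶠ[nhds j] fun k =>
      ∑ μ, ((d μ k.1)⁻¹ * k.2.2.2 μ μ + diagLapCoeff d μ k.1 * k.2.2.1 μ) - V k.1 * k.2.1 := by
    filter_upwards [continuous_fst.continuousAt.preimage_mem_nhds hn] with k hk
    exact kgOperator_diagMetric hM h0 hk
  have h1 : ∀ μ, HasFDerivAt (fun k : Jet2 n => (d μ k.1)⁻¹) _ j := fun μ =>
    hasFDerivAt_fst (f := fun y => (d μ y)⁻¹)
      ((((hd μ).contDiffAt hn).inv (h0 μ _ hj)).differentiableAt (by simp))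
  have h2 : ∀ μ, HasFDerivAt (fun k : Jet2 n => diagLapCoeff d μ k.1) _ j := fun μ =>
    hasFDerivAt_fst ((contDiffAt_diagLapCoeff (fun i => (hd i).contDiffAt hn)
      (fun i => h0 i _ hj) μ).differentiableAt (by simp))
  have h3 : HasFDerivAt (fun k : Jet2 n => V k.1) _ j :=
    hasFDerivAt_fst ((hV.contDiffAt hn).differentiableAt (by simp))
  have h4 := (HasFDerivAt.fun_sum fun μ (_ : μ ∈ Finset.univ) =>
    ((h1 μ).fun_mul (hasFDerivAt_jet_hessian j μ)).fun_add
      ((h2 μ).fun_mul (hasFDerivAt_jet_slope j μ))).fun_sub (h3.fun_mul (hasFDerivAt_jet_value j))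
  unfold applyProlong2
  rw [e.fderiv_eq, h4.fderiv, kgOperator_diagMetric hM h0 hj]
  simp only [prolong2_linearField hM hc hj, prolong1_linearField (j := j.toJet1) hcd, sub_apply,
    sum_apply, add_apply, smul_apply, ContinuousLinearMap.comp_apply,
    ContinuousLinearMap.coe_fst', ContinuousLinearMap.coe_snd', ContinuousLinearMap.proj_apply,
    smul_eq_mul]
  have e1 : (linearField (affineField a b) c).ξ (j.1, j.2.1) = affineField a b j.1 := rfl
  have e2 : (linearField (affineField a b) c).η (j.1, j.2.1) = c j.1 * j.2.1 := rfl
  have e3 : j.toJet1 = (j.1, j.2.1, j.2.2.1) := rfl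
  simp only [e1, e2, e3, fderiv_inv_diag hM hd h0 hξ hj, fderiv_diagLapCoeff hM hd h0 hψ hξ hj,
    diagLap]
  have hpd : ∀ μ, 2 * pd μ c j.1 = (2 - n) * pd μ ψ j.1 := by
    intro μ
    have e4 : (fun y => 2 * c y) =ᶠ[nhds j.1] fun y => (2 - n) * ψ y := by
      filter_upwards [hn] with y hy using hcψ y hy
    have e5 := e4.fderiv_eq (𝕜 := ℝ)
    rw [fderiv_const_mul hcd,
      fderiv_const_mul ((hψ.contDiffAt hn).differentiableAt (by simp))] at e5
    simpa [pd] using congrArg (fun L => L (Pi.single μ 1)) e5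
  rw [mul_sub, mul_sub, mul_sub, Finset.mul_sum, Finset.mul_sum, ← sub_eq_zero]
  rw [show ∀ s1 s2 s3 p q r w z : ℝ, s1 - p - (s2 - q + (s3 - r - w)) = z ↔
    (s1 - s2 - s3) - (p - q - r - w) = z from fun _ _ _ _ _ _ _ _ => by ring_nf,
    ← Finset.sum_sub_distrib, ← Finset.sum_sub_distrib]
  -- Index by index, the second derivatives match `(c - 2ψ)H` and the terms in `u` match `Δc`. What
  -- is left is `u_μ (2c_{,μ} + (n - 2)ψ_{,μ}) / d_μ`, which vanishes by `hpd`.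
  rw [Finset.sum_eq_zero fun μ _ => ?_]
  · ring
  · linear_combination (d μ j.1)⁻¹ * j.2.2.1 μ * hpd μ

/-- The potentials for which `ξ + c u ∂_u` is a Lie symmetry. -/
theorem kgLie_diagMetric_iff (hn : 0 < n) (hM : IsOpen M) (hd : ∀ i, ContDiffOn ℝ ∞ (d i) M)
    (h0 : ∀ i, ∀ x ∈ M, d i x ≠ 0) (hψ : ContDiffOn ℝ ∞ ψ M) (hc : ContDiffOn ℝ ∞ c M)
    (hV : ContDiffOn ℝ ∞ V M)
    (hξ : ∀ i, ∀ x ∈ M, fderiv ℝ (d i) x (affineField a b x) = 2 * (ψ x - b i) * d i x)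
    (hcψ : ∀ x ∈ M, 2 * c x = (2 - n) * ψ x) :
    KGLie M (diagMetric d) V (linearField (affineField a b) c) ↔
      ∀ x ∈ M, fderiv ℝ V x (affineField a b x) + 2 * ψ x * V x = diagLap d c x := by
  constructor
  · intro h x hx
    let i : Fin n := ⟨0, hn⟩
    have hi := h0 i x hx
    -- A test jet on the equation: `u = 1`, zero gradient, and a single Hessian entry `d_i V` chosen
    -- to make `Δu = V`. On it the symmetry condition is precisely the coefficient of `u`.
    let j : Jet2 n := (x, 1, 0, fun μ ν => if μ = ν then if μ = i then d i x * V x else 0 else 0)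
    have hj : kgOperator (diagMetric d) V j = 0 := by
      rw [kgOperator_diagMetric hM h0 (show j.1 ∈ M from hx)]
      simp [j, hi]
    have h1 := h j hx (fun μ ν => by
      by_cases e : μ = ν
      · subst e; rfl
      · simp [j, e, Ne.symm e]) hj
    rw [applyProlong2_kgOperator hM hd h0 hψ hc hV hξ hcψ (show j.1 ∈ M from hx), hj] at h1
    simp only [j] at h1
    linarith
  · intro h j hj _ hH
    rw [applyProlong2_kgOperator hM hd h0 hψ hc hV hξ hcψ hj, hH]
    linear_combination -j.2.1 * h j.1 hj

/-- The same potentials make `ξ + c u ∂_u` a Noether symmetry. -/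
theorem kgNoether_diagMetric_iff (hn : 0 < n) (hM : IsOpen M)
    (hd : ∀ i, ContDiffOn ℝ ∞ (d i) M)
    (h0 : ∀ i, ∀ x ∈ M, d i x ≠ 0) (hψ : ContDiffOn ℝ ∞ ψ M) (hc : ContDiffOn ℝ ∞ c M)
    (hV : ContDiffOn ℝ ∞ V M)
    (hξ : ∀ i, ∀ x ∈ M, fderiv ℝ (d i) x (affineField a b x) = 2 * (ψ x - b i) * d i x)
    (hcψ : ∀ x ∈ M, 2 * c x = (2 - n) * ψ x) :
    KGNoether M (diagMetric d) V (linearField (affineField a b) c) ↔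
      ∀ x ∈ M, fderiv ℝ V x (affineField a b x) + 2 * ψ x * V x = diagLap d c x := by
  have hLie := kgLie_diagMetric_iff hn hM hd h0 hψ hc hV hξ hcψ
  refine ⟨fun h => hLie.1 h.1, fun h => ⟨hLie.2 h, ?_⟩⟩
  have hR : ∀ μ, ∀ x ∈ M, ContDiffAt ℝ ∞
      (fun y => 1 / 2 * (volDensity (diagMetric d) y * (d μ y)⁻¹ * pd μ c y)) x := fun μ x hx =>
    contDiffAt_const.mul ((contDiffAt_density_inv (fun i => (hd i).contDiffAt (hM.mem_nhds hx))
      (fun i => h0 i x hx) μ).mul (contDiffAt_pd (hc.contDiffAt (hM.mem_nhds hx)) μ))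
  -- The flux `½ |g|^{1/2} g^{μμ} c_{,μ} u²`: its divergence yields the cross term in `u u_μ`
  -- produced by the non-constant `c`, together with `½ |g|^{1/2} (Δc) u²`, which the equation for
  -- `V` balances.
  refine ⟨fun w μ => 1 / 2 * (volDensity (diagMetric d) w.1 * (d μ w.1)⁻¹ * pd μ c w.1)
    * w.2 ^ 2, ?_, ?_⟩
  · refine contDiffOn_pi.2 fun μ w hw => ContDiffAt.contDiffWithinAt ?_
    exact ((hR μ w.1 hw.1).comp w contDiffAt_fst).mul (contDiffAt_snd.pow 2)
  · intro j hj
    have hn := hM.mem_nhds hj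
    have hcd : DifferentiableAt ℝ c j.1 := (hc.contDiffAt hn).differentiableAt (by simp)
    have hρ := contDiffAt_volDensity (fun i => (hd i).contDiffAt hn) (fun i => h0 i _ hj)
    have e : kgLagrangian (diagMetric d) V =ᶠ[nhds j] fun k =>
        1 / 2 * volDensity (diagMetric d) k.1 *
          (∑ μ, (d μ k.1)⁻¹ * k.2.2 μ ^ 2 + V k.1 * k.2.1 ^ 2) := by
      filter_upwards [continuous_fst.continuousAt.preimage_mem_nhds hn] with k hk
      exact kgLagrangian_diagMetric h0 hk
    have h1 : ∀ μ, HasFDerivAt (fun k : Jet1 n => (d μ k.1)⁻¹) _ j := fun μ =>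
      hasFDerivAt_fst (f := fun y => (d μ y)⁻¹)
        ((((hd μ).contDiffAt hn).inv (h0 μ _ hj)).differentiableAt (by simp))
    have h2 : HasFDerivAt (fun k : Jet1 n => volDensity (diagMetric d) k.1) _ j :=
      hasFDerivAt_fst (hρ.differentiableAt (by simp))
    have h3 : HasFDerivAt (fun k : Jet1 n => V k.1) _ j :=
      hasFDerivAt_fst ((hV.contDiffAt hn).differentiableAt (by simp))
    have h4 := (h2.const_mul (1 / 2)).fun_mul ((HasFDerivAt.fun_sum fun μ
      (_ : μ ∈ Finset.univ) => (h1 μ).fun_mul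
        (HasFDerivAt.pow (hasFDerivAt_pi'.1 (hasFDerivAt_snd (𝕜 := ℝ) (p := j)).snd μ) 2)).fun_add
      (h3.fun_mul (HasFDerivAt.pow (hasFDerivAt_jet_value j) 2)))
    have h5 : ∀ μ, totalD0 (fun w : Coord n × ℝ => 1 / 2 *
        (volDensity (diagMetric d) w.1 * (d μ w.1)⁻¹ * pd μ c w.1) * w.2 ^ 2) μ j
        = 1 / 2 * volDensity (diagMetric d) j.1 *
            ((d μ j.1)⁻¹ * pd μ (pd μ c) j.1 + diagLapCoeff d μ j.1 * pd μ c j.1) * j.2.1 ^ 2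
          + volDensity (diagMetric d) j.1 * (d μ j.1)⁻¹ * pd μ c j.1 * j.2.1 * j.2.2 μ := by
      intro μ
      have k1 := hasFDerivAt_fst (j := (j.1, j.2.1)) ((hR μ j.1 hj).differentiableAt (by simp))
      have k2 := HasFDerivAt.pow (hasFDerivAt_snd (𝕜 := ℝ) (p := (j.1, j.2.1))) 2
      have k3 := volDensity_pos h0 hj
      rw [totalD0, (k1.fun_mul k2).fderiv]
      simp only [add_apply, smul_apply, ContinuousLinearMap.comp_apply,
        ContinuousLinearMap.coe_fst', ContinuousLinearMap.coe_snd', smul_eq_mul]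
      rw [fderiv_const_mul (((contDiffAt_density_inv (fun i => (hd i).contDiffAt hn)
        (fun i => h0 i _ hj) μ).mul (contDiffAt_pd (hc.contDiffAt hn) μ)).differentiableAt
          (by simp)), smul_apply, fderiv_mul_apply
        ((contDiffAt_density_inv (fun i => (hd i).contDiffAt hn)
          (fun i => h0 i _ hj) μ).differentiableAt (by simp))
        ((contDiffAt_pd (hc.contDiffAt hn) μ).differentiableAt (by simp))]
      simp only [diagLapCoeff]
      simp only [pd, smul_eq_mul]
      field_simp
      ring
    have h6 := h j.1 hj
    unfold applyProlong1
    rw [e.fderiv_eq, h4.fderiv, kgLagrangian_diagMetric h0 hj]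
    have e1 : (linearField (affineField a b) c).ξ (j.1, j.2.1) = affineField a b j.1 := rfl
    have e2 : (linearField (affineField a b) c).η (j.1, j.2.1) = c j.1 * j.2.1 := rfl
    have e4 : ∀ μ, totalD0 (fun w => (linearField (affineField a b) c).ξ w μ) μ j = b μ :=
      fun μ => (totalD0_affineField j μ μ).trans (if_pos rfl)
    simp only [h5, e1, e2, e4, prolong1_linearField hcd, add_apply,
      sum_apply, smul_apply, ContinuousLinearMap.comp_apply,
      ContinuousLinearMap.coe_fst', ContinuousLinearMap.coe_snd', ContinuousLinearMap.proj_apply,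
      smul_eq_mul, fderiv_inv_diag hM hd h0 hξ hj, fderiv_density hM hd h0 hξ hj]
    set ρ := volDensity (diagMetric d) j.1
    have s1 : ∑ μ, ((d μ j.1)⁻¹ * (2 • j.2.2 μ ^ (2 - 1) *
          (pd μ c j.1 * j.2.1 + (c j.1 - b μ) * j.2.2 μ))
          + j.2.2 μ ^ 2 * (2 * (b μ - ψ j.1) * (d μ j.1)⁻¹))
        = 2 * j.2.1 * ∑ μ, (d μ j.1)⁻¹ * pd μ c j.1 * j.2.2 μ
          + (2 * c j.1 - 2 * ψ j.1) * ∑ μ, (d μ j.1)⁻¹ * j.2.2 μ ^ 2 := by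
      rw [Finset.mul_sum, Finset.mul_sum, ← Finset.sum_add_distrib]
      refine Finset.sum_congr rfl fun μ _ => ?_
      norm_num
      ring
    have s2 : ∑ μ, (1 / 2 * ρ * ((d μ j.1)⁻¹ * pd μ (pd μ c) j.1
          + diagLapCoeff d μ j.1 * pd μ c j.1) * j.2.1 ^ 2
          + ρ * (d μ j.1)⁻¹ * pd μ c j.1 * j.2.1 * j.2.2 μ)
        = 1 / 2 * ρ * j.2.1 ^ 2 * diagLap d c j.1
          + ρ * j.2.1 * ∑ μ, (d μ j.1)⁻¹ * pd μ c j.1 * j.2.2 μ := by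
      rw [diagLap, Finset.mul_sum, Finset.mul_sum, ← Finset.sum_add_distrib]
      refine Finset.sum_congr rfl fun μ _ => ?_
      ring
    rw [s1, s2]
    norm_num
    linear_combination 1 / 2 * ρ * j.2.1 ^ 2 * h6
      + 1 / 2 * ρ * (∑ μ, (d μ j.1)⁻¹ * j.2.2 μ ^ 2 + V j.1 * j.2.1 ^ 2) * hcψ j.1 hj

end Diagonal

end General

section Flows

/-! Functions constant along flows. -/

theorem isOpen_slab {I : Set ℝ} (hI : IsOpen I) : IsOpen (slab I) :=
  hI.preimage (continuous_apply 0)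

/-- By the chain rule `ξ(V)` is the derivative of `V` along the flow. The flow is complete and
preserves `M`, so orbits are parametrized by all of ℝ and a vanishing derivative means constancy. -/
theorem fderiv_eq_zero_iff_flow {n : ℕ} {M : Set (Coord n)} (hM : IsOpen M) {V : Coord n → ℝ}
    (hV : ContDiffOn ℝ ∞ V M) (ξ : Coord n → Coord n) (σ : ℝ → Coord n → Coord n)
    (hσ : ∀ p s, HasDerivAt (fun r => σ r p) (ξ (σ s p)) s) (hσ0 : ∀ p, σ 0 p = p)
    (hσM : ∀ p ∈ M, ∀ s, σ s p ∈ M) :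
    (∀ p ∈ M, fderiv ℝ V p (ξ p) = 0) ↔ ∀ p ∈ M, ∀ s, V (σ s p) = V p := by
  have hd : ∀ p ∈ M, ∀ s, HasDerivAt (fun r => V (σ r p))
      (fderiv ℝ V (σ s p) (ξ (σ s p))) s := fun p hp s =>
    ((hV.contDiffAt (hM.mem_nhds (hσM p hp s))).differentiableAt
      (by simp)).hasFDerivAt.comp_hasDerivAt s (hσ p s)
  constructor
  · intro h p hp s
    have := is_const_of_deriv_eq_zero (f := fun r => V (σ r p))
      (fun r => (hd p hp r).differentiableAt)
      (fun r => by rw [(hd p hp r).deriv, h _ (hσM p hp r)]) s 0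
    simpa [hσ0] using this
  · intro h p hp
    have h1 := hd p hp 0
    simp only [h p hp, hσ0] at h1
    exact h1.unique (hasDerivAt_const 0 (V p))

theorem hasDerivAt_vec4 {f g h k : ℝ → ℝ} {f' g' h' k' s : ℝ} (hf : HasDerivAt f f' s)
    (hg : HasDerivAt g g' s) (hh : HasDerivAt h h' s) (hk : HasDerivAt k k' s) :
    HasDerivAt (fun r => (![f r, g r, h r, k r] : Coord 4)) ![f', g', h', k'] s := by
  rw [hasDerivAt_pi]
  intro i
  fin_cases i
  · exact hf
  · exact hg
  · exact hh
  · exact hk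

theorem contDiff_vec4 {E : Type*} [NormedAddCommGroup E] [NormedSpace ℝ E] {f g h k : E → ℝ}
    (hf : ContDiff ℝ ∞ f) (hg : ContDiff ℝ ∞ g) (hh : ContDiff ℝ ∞ h) (hk : ContDiff ℝ ∞ k) :
    ContDiff ℝ ∞ (fun r => (![f r, g r, h r, k r] : Coord 4)) := by
  rw [contDiff_pi]
  intro i
  fin_cases i
  · exact hf
  · exact hg
  · exact hh
  · exact hk

theorem vec4_eta (p : Coord 4) : ![p 0, p 1, p 2, p 3] = p := by
  ext i
  fin_cases i <;> rfl

theorem hasDerivAt_exp_mul (a s : ℝ) :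
    HasDerivAt (fun r => Real.exp (a * r)) (Real.exp (a * s) * a) s := by
  simpa using ((hasDerivAt_id s).const_mul a).exp

variable {I : Set ℝ} {V : Coord 4 → ℝ}

theorem fderiv_kv2_eq_zero_iff (hI : IsOpen I) (hV : ContDiffOn ℝ ∞ V (slab I)) :
    (∀ p ∈ slab I, fderiv ℝ V p (kv2 p) = 0) ↔ PotII I V := by
  rw [fderiv_eq_zero_iff_flow (isOpen_slab hI) hV kv2
    (fun s p => ![p 0, p 1, p 2 + s, p 3])
    (fun p s => hasDerivAt_vec4 (hasDerivAt_const _ _) (hasDerivAt_const _ _)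
      ((hasDerivAt_id s).const_add (p 2)) (hasDerivAt_const _ _))
    (fun p => by simpa using vec4_eta p) (fun p hp s => hp)]
  constructor
  · intro h
    -- `W` is the restriction of `V` to the slice `y = 0`, which the flow reaches at time `-y`.
    refine ⟨fun q => V ![q.1, q.2.1, 0, q.2.2], hV.comp (contDiff_vec4 (by fun_prop)
      (by fun_prop) (by fun_prop) (by fun_prop)).contDiffOn fun q hq => hq.1, ?_⟩
    intro t ht x y z
    have := h ![t, x, y, z] ht (-y)
    simpa using this.symm
  · rintro ⟨W, _, hW⟩ p hp s
    rw [hW _ hp, ← hW _ hp _ (p 2), vec4_eta]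

theorem fderiv_kv3_eq_zero_iff (hI : IsOpen I) (hV : ContDiffOn ℝ ∞ V (slab I)) :
    (∀ p ∈ slab I, fderiv ℝ V p (kv3 p) = 0) ↔ PotIII I V := by
  rw [fderiv_eq_zero_iff_flow (isOpen_slab hI) hV kv3
    (fun s p => ![p 0, p 1, p 2, p 3 + s])
    (fun p s => hasDerivAt_vec4 (hasDerivAt_const _ _) (hasDerivAt_const _ _)
      (hasDerivAt_const _ _) ((hasDerivAt_id s).const_add (p 3)))
    (fun p => by simpa using vec4_eta p) (fun p hp s => hp)]
  constructor
  · intro h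
    refine ⟨fun q => V ![q.1, q.2.1, q.2.2, 0], hV.comp (contDiff_vec4 (by fun_prop)
      (by fun_prop) (by fun_prop) (by fun_prop)).contDiffOn fun q hq => hq.1, ?_⟩
    intro t ht x y z
    have := h ![t, x, y, z] ht (-z)
    simpa using this.symm
  · rintro ⟨W, _, hW⟩ p hp s
    rw [hW _ hp, ← hW _ hp _ _ (p 3), vec4_eta]

/-- The flow translates `x` at speed `α` and scales `y - β/α` and `z - γ/α` by `e^{-αs}`, so their
products with `e^x` are invariants. -/
theorem fderiv_kv_combination_eq_zero_iff (hI : IsOpen I) (hV : ContDiffOn ℝ ∞ V (slab I))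
    {α : ℝ} (hα : α ≠ 0) (β γ : ℝ) :
    (∀ p ∈ slab I, fderiv ℝ V p ((α • kv1 + β • kv2 + γ • kv3) p) = 0) ↔
      PotIV I α β γ V := by
  rw [fderiv_eq_zero_iff_flow (isOpen_slab hI) hV (α • kv1 + β • kv2 + γ • kv3)
    (fun s p => ![p 0, p 1 + α * s, β / α + (p 2 - β / α) * Real.exp (-α * s),
      γ / α + (p 3 - γ / α) * Real.exp (-α * s)])
    (fun p s => by
      refine (hasDerivAt_vec4 (hasDerivAt_const s (p 0))
        (((hasDerivAt_id s).const_mul α).const_add (p 1))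
        (((hasDerivAt_exp_mul (-α) s).const_mul (p 2 - β / α)).const_add (β / α))
        (((hasDerivAt_exp_mul (-α) s).const_mul (p 3 - γ / α)).const_add (γ / α))).congr_deriv ?_
      ext i
      fin_cases i
      · simp [kv1, kv2, kv3]
      · simp [kv1, kv2, kv3]
      · simp [kv1, kv2, kv3]
        field_simp
        ring
      · simp [kv1, kv2, kv3]
        field_simp
        ring)
    (fun p => by simpa using vec4_eta p) (fun p hp s => hp)]
  constructor
  · intro h
    -- `W` is read off on the slice `x = 0`, reached from `(t, x, y, z)` at time `-x/α`.
    refine ⟨fun q => V ![q.1, 0, β / α + q.2.1, γ / α + q.2.2], hV.comp (contDiff_vec4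
      (by fun_prop) (by fun_prop) (by fun_prop) (by fun_prop)).contDiffOn fun q hq => hq.1, ?_⟩
    intro t ht x y z
    have := h ![t, x, y, z] ht (-x / α)
    have e1 : α * (-x / α) = -x := by field_simp
    have e2 : -α * (-x / α) = x := by field_simp
    rw [e1, e2] at this
    simpa using this.symm
  · rintro ⟨W, _, hW⟩ p hp s
    rw [hW _ hp, ← vec4_eta p, hW _ hp]
    have e : Real.exp (-α * s) * Real.exp (p 1 + α * s) = Real.exp (p 1) := by
      rw [← Real.exp_add]; congr 1; ring
    simp [mul_assoc, ← e]

theorem potI_iff : PotI I V ↔ PotIV I 1 0 0 V := by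
  simp only [PotI, PotIV, zero_div, sub_zero, mul_comm]

/-- Invariance up to a weight `w(t)` and a source `v(t)` along the field
`∂_t + a ∂_x - k (y - y₀) ∂_y - q (z - z₀) ∂_z`. -/
theorem weighted_fderiv_eq_iff (hI : IsOpen I) (hIc : I.OrdConnected)
    (hV : ContDiffOn ℝ ∞ V (slab I)) {w v : ℝ → ℝ} (hw : DifferentiableOn ℝ w I)
    (hv : DifferentiableOn ℝ v I) (a k y₀ q z₀ : ℝ) :
    (∀ p ∈ slab I, w (p 0) * fderiv ℝ V p ![1, a, -k * (p 2 - y₀), -q * (p 3 - z₀)]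
        + deriv w (p 0) * V p = deriv v (p 0)) ↔
      ∃ U : ℝ × ℝ × ℝ → ℝ, ContDiff ℝ ∞ U ∧ ∀ t ∈ I, ∀ x y z : ℝ,
        w t * V ![t, x, y, z] - v t
          = U (x - a * t, (y - y₀) * Real.exp (k * t), (z - z₀) * Real.exp (q * t)) := by
  have hM := isOpen_slab hI
  -- Integral curves parametrized by `t`; the labels `X`, `Y`, `Z` are the three invariants that
  -- appear as arguments of `U`.
  let σ : ℝ → ℝ → ℝ → ℝ → Coord 4 := fun X Y Z t =>
    ![t, X + a * t, y₀ + Y * Real.exp (-k * t), z₀ + Z * Real.exp (-q * t)]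
  have hσ : ∀ X Y Z t, HasDerivAt (σ X Y Z)
      ![1, a, -k * (σ X Y Z t 2 - y₀), -q * (σ X Y Z t 3 - z₀)] t := by
    intro X Y Z t
    refine (hasDerivAt_vec4 (hasDerivAt_id t) (((hasDerivAt_id t).const_mul a).const_add X)
      (((hasDerivAt_exp_mul (-k) t).const_mul Y).const_add y₀)
      (((hasDerivAt_exp_mul (-q) t).const_mul Z).const_add z₀)).congr_deriv ?_
    ext i
    fin_cases i
    · simp
    · simp
    · simp [σ]
      ring
    · simp [σ]
      ring
  have hd : ∀ X Y Z, ∀ t ∈ I, HasDerivAt (fun r => w r * V (σ X Y Z r) - v r)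
      (deriv w t * V (σ X Y Z t) + w t * fderiv ℝ V (σ X Y Z t)
        ![1, a, -k * (σ X Y Z t 2 - y₀), -q * (σ X Y Z t 3 - z₀)] - deriv v t) t := by
    intro X Y Z t ht
    have h1 := ((hw t ht).differentiableAt (hI.mem_nhds ht)).hasDerivAt
    have h2 := ((hv t ht).differentiableAt (hI.mem_nhds ht)).hasDerivAt
    have h3 : HasDerivAt (fun r => V (σ X Y Z r)) _ t :=
      ((hV.contDiffAt (hM.mem_nhds (show σ X Y Z t ∈ slab I from ht))).differentiableAt
      (by simp)).hasFDerivAt.comp_hasDerivAt t (hσ X Y Z t)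
    exact (h1.fun_mul h3).fun_sub h2
  have hσe : ∀ t x y z, σ (x - a * t) ((y - y₀) * Real.exp (k * t))
      ((z - z₀) * Real.exp (q * t)) t = ![t, x, y, z] := by
    intro t x y z
    simp [σ, mul_assoc, ← Real.exp_add]
  constructor
  · intro h
    rcases I.eq_empty_or_nonempty with rfl | ⟨t₀, ht₀⟩
    · exact ⟨0, contDiff_const, by simp⟩
    -- `U` is the conserved quantity on the slice `t = t₀`. Connectedness of `I` carries it to all
    -- other times.
    refine ⟨fun u => w t₀ * V (σ u.1 u.2.1 u.2.2 t₀) - v t₀, ?_, ?_⟩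
    · refine (contDiff_const.mul ?_).sub contDiff_const
      rw [← contDiffOn_univ]
      exact hV.comp (contDiff_vec4 (by fun_prop)
        (by fun_prop) (by fun_prop) (by fun_prop)).contDiffOn fun u _ => ht₀
    · intro t ht x y z
      set X := x - a * t
      set Y := (y - y₀) * Real.exp (k * t)
      set Z := (z - z₀) * Real.exp (q * t)
      have := hI.is_const_of_deriv_eq_zero hIc.isPreconnected
        (f := fun r => w r * V (σ X Y Z r) - v r)
        (fun r hr => (hd X Y Z r hr).differentiableAt.differentiableWithinAt)
        (fun r hr => by
          rw [(hd X Y Z r hr).deriv]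
          have := h (σ X Y Z r) hr
          rw [show σ X Y Z r 0 = r from rfl] at this
          simp only [Pi.zero_apply]
          linear_combination this) ht ht₀
      beta_reduce at this
      rw [hσe] at this
      exact this
  · rintro ⟨U, _, hU⟩ p hp
    have hp' : p 0 ∈ I := hp
    set X := p 1 - a * p 0
    set Y := (p 2 - y₀) * Real.exp (k * p 0)
    set Z := (p 3 - z₀) * Real.exp (q * p 0)
    have e : (fun r => w r * V (σ X Y Z r) - v r) =ᶠ[nhds (p 0)] fun _ => U (X, Y, Z) := by
      filter_upwards [hI.mem_nhds hp'] with r hr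
      rw [hU r hr]
      simp [mul_assoc, ← Real.exp_add]
    have h1 := (hd X Y Z (p 0) hp').unique ((hasDerivAt_const (p 0) _).congr_of_eventuallyEq e)
    rw [hσe, vec4_eta] at h1
    linear_combination h1

end Flows

section Warped

/-! Diagonal metrics `F₀(t) dt² + F₁(t) dx² + e^{2x} (F₂(t) dy² + F₃(t) dz²)`. -/

def warpExponent : Fin 4 → ℝ := ![0, 0, 2, 2]

def warp (F : Fin 4 → ℝ → ℝ) (i : Fin 4) (p : Coord 4) : ℝ :=
  F i (p 0) * Real.exp (warpExponent i * p 1)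

variable {I : Set ℝ} {V : Coord 4 → ℝ} {F : Fin 4 → ℝ → ℝ}

theorem contDiffOn_comp_zero {f : ℝ → ℝ} (hf : ContDiffOn ℝ ∞ f I) :
    ContDiffOn ℝ ∞ (fun p : Coord 4 => f (p 0)) (slab I) :=
  hf.comp (contDiff_apply ℝ ℝ (0 : Fin 4)).contDiffOn fun _ hp => hp

theorem contDiffOn_warp (hF : ∀ i, ContDiffOn ℝ ∞ (F i) I) (i : Fin 4) :
    ContDiffOn ℝ ∞ (warp F i) (slab I) :=
  (contDiffOn_comp_zero (hF i)).mul
    (contDiff_const.mul (contDiff_apply ℝ ℝ (1 : Fin 4))).exp.contDiffOn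

theorem warp_ne_zero (hF : ∀ i, ∀ t ∈ I, F i t ≠ 0) (i : Fin 4) (p : Coord 4)
    (hp : p ∈ slab I) : warp F i p ≠ 0 :=
  mul_ne_zero (hF i _ hp) (Real.exp_pos _).ne'

theorem hasFDerivAt_comp_apply {f : ℝ → ℝ} {f' : ℝ} {p : Coord 4} {i : Fin 4}
    (hf : HasDerivAt f f' (p i)) :
    HasFDerivAt (fun q : Coord 4 => f (q i))
      (f' • ContinuousLinearMap.proj (R := ℝ) (φ := fun _ : Fin 4 => ℝ) i) p :=
  hf.comp_hasFDerivAt p (hasFDerivAt_apply i p)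

theorem fderiv_warp {i : Fin 4} {p : Coord 4} {F' : ℝ} (hF : HasDerivAt (F i) F' (p 0))
    (v : Coord 4) :
    fderiv ℝ (warp F i) p v
      = (F' * v 0 + warpExponent i * F i (p 0) * v 1) * Real.exp (warpExponent i * p 1) := by
  have h := (hasFDerivAt_comp_apply hF).fun_mul
    (hasFDerivAt_comp_apply (hasDerivAt_exp_mul (warpExponent i) (p 1)))
  have e : warp F i = fun q => F i (q 0) * Real.exp (warpExponent i * q 1) := rfl
  rw [e, h.fderiv]
  simp
  ring

theorem pd_comp_zero {f : ℝ → ℝ} {f' : ℝ} {p : Coord 4} (hf : HasDerivAt f f' (p 0))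
    (μ : Fin 4) : pd μ (fun q => f (q 0)) p = if μ = 0 then f' else 0 := by
  rw [pd, (hasFDerivAt_comp_apply hf).fderiv]
  fin_cases μ <;> simp

theorem volDensity_warp (F : Fin 4 → ℝ → ℝ) (p : Coord 4) :
    volDensity (diagMetric (warp F)) p
      = Real.sqrt |∏ i, F i (p 0)| * Real.exp (2 * p 1) := by
  rw [volDensity_diagMetric]
  have e : ∏ i, warp F i p = (∏ i, F i (p 0)) * Real.exp (2 * p 1) ^ 2 := by
    simp only [warp, Finset.prod_mul_distrib]
    congr 1
    simp [Fin.prod_univ_four, warpExponent]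
    ring
  rw [e, abs_mul, Real.sqrt_mul (abs_nonneg _), abs_of_nonneg (sq_nonneg (Real.exp _)),
    Real.sqrt_sq (Real.exp_pos _).le]

/-- On functions of `t` alone only the index 0 contributes. The factor `e^{2x}` of the density
cancels, leaving an ordinary differential operator in `t`. -/
theorem diagLap_warp (hI : IsOpen I) {f f₁ f₂ s σ σ₁ : ℝ → ℝ}
    (hf : ∀ t ∈ I, HasDerivAt f (f₁ t) t) (hf₁ : ∀ t ∈ I, HasDerivAt f₁ (f₂ t) t)
    (hs : ∀ t ∈ I, Real.sqrt |∏ i, F i t| = s t) (hσ : ∀ t ∈ I, s t * (F 0 t)⁻¹ = σ t)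
    (hσ₁ : ∀ t ∈ I, HasDerivAt σ (σ₁ t) t) {p : Coord 4} (hp : p ∈ slab I) :
    diagLap (warp F) (fun q => f (q 0)) p
      = (F 0 (p 0))⁻¹ * f₂ (p 0) + (s (p 0))⁻¹ * σ₁ (p 0) * f₁ (p 0) := by
  have hn := (isOpen_slab hI).mem_nhds hp
  have e1 : pd 0 (fun q : Coord 4 => f (q 0)) =ᶠ[nhds p] fun q => f₁ (q 0) := by
    filter_upwards [hn] with q hq using (pd_comp_zero (hf _ hq) 0).trans (if_pos rfl)
  have e2 : pd 0 (pd 0 fun q : Coord 4 => f (q 0)) p = f₂ (p 0) := by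
    rw [pd, e1.fderiv_eq]
    exact (pd_comp_zero (hf₁ _ hp) 0).trans (if_pos rfl)
  have e3 : ∀ μ, μ ≠ 0 → pd μ (fun q : Coord 4 => f (q 0)) =ᶠ[nhds p] fun _ => 0 := by
    intro μ hμ
    filter_upwards [hn] with q hq using (pd_comp_zero (hf _ hq) μ).trans (if_neg hμ)
  have e4 : diagLapCoeff (warp F) 0 p = (s (p 0))⁻¹ * σ₁ (p 0) := by
    have e5 : (fun q => volDensity (diagMetric (warp F)) q * (warp F 0 q)⁻¹) =ᶠ[nhds p]
        fun q => σ (q 0) * Real.exp (2 * q 1) := by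
      filter_upwards [hn] with q hq
      rw [volDensity_warp, hs _ hq, ← hσ _ hq]
      simp [warp, warpExponent]
      ring
    have h := (hasFDerivAt_comp_apply (hσ₁ _ hp)).fun_mul
      (hasFDerivAt_comp_apply (hasDerivAt_exp_mul 2 (p 1)))
    rw [diagLapCoeff, volDensity_warp, hs _ hp, pd, e5.fderiv_eq, h.fderiv]
    simp
    field_simp
  unfold diagLap
  rw [Finset.sum_eq_single 0]
  · rw [e2, e4, e1.eq_of_nhds]
    simp [warp, warpExponent]
  · intro μ _ hμ
    rw [(e3 μ hμ).eq_of_nhds, pd, (e3 μ hμ).fderiv_eq]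
    simp
  · simp

theorem diagLap_zero {n : ℕ} (d : Fin n → Coord n → ℝ) (x : Coord n) : diagLap d 0 x = 0 := by
  have h : ∀ μ, pd μ (0 : Coord n → ℝ) = 0 := fun μ => by
    funext y
    simp [pd]
  simp [diagLap, h]

/-! The Bianchi V metrics and their Killing vectors. -/

theorem bianchiV_eq (N A B C : ℝ → ℝ) :
    bianchiV N A B C = diagMetric
      (warp ![fun t => -(N t) ^ 2, fun t => A t ^ 2, fun t => B t ^ 2, fun t => C t ^ 2]) := by
  funext p
  unfold bianchiV diagMetric
  congr 1
  funext i
  fin_cases i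
  · simp [warp, warpExponent]
  · simp [warp, warpExponent]
  · simp [warp, warpExponent, ← Real.exp_nat_mul]
  · simp [warp, warpExponent, ← Real.exp_nat_mul]

theorem kv_combination_eq (α β γ : ℝ) :
    α • kv1 + β • kv2 + γ • kv3 = affineField ![0, α, β, γ] ![0, 0, -α, -α] := by
  funext p i
  fin_cases i <;> simp [affineField, kv1, kv2, kv3] <;> ring

theorem fderiv_warp_kv_combination (hI : IsOpen I) (hF : ∀ i, ContDiffOn ℝ ∞ (F i) I)
    (α β γ : ℝ) (i : Fin 4) (p : Coord 4) (hp : p ∈ slab I) :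
    fderiv ℝ (warp F i) p (affineField ![0, α, β, γ] ![0, 0, -α, -α] p)
      = 2 * ((0 : Coord 4 → ℝ) p - (![0, 0, -α, -α] : Fin 4 → ℝ) i) * warp F i p := by
  rw [fderiv_warp (((hF i).contDiffAt (hI.mem_nhds hp)).differentiableAt (by simp)).hasDerivAt]
  fin_cases i <;> simp [affineField, warp, warpExponent] <;> ring

theorem isKilling_kv_combination (hI : IsOpen I) (hF : ∀ i, ContDiffOn ℝ ∞ (F i) I)
    (α β γ : ℝ) :
    IsKilling (slab I) (diagMetric (warp F)) (α • kv1 + β • kv2 + γ • kv3) := by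
  intro p hp μ ν
  rw [kv_combination_eq, lieMetric_diagMetric, fderiv_warp_kv_combination hI hF α β γ μ p hp]
  split_ifs
  · simp
  · rfl

/-- With `ψ = c = 0` the condition on `V` is `ξ(V) = 0`. Keeping `P` abstract covers `α = 0` as
well, where the slice has to be chosen differently. -/
theorem kg_kv_combination_iff (hI : IsOpen I) (hV : ContDiffOn ℝ ∞ V (slab I))
    (hF : ∀ i, ContDiffOn ℝ ∞ (F i) I) (hF0 : ∀ i, ∀ t ∈ I, F i t ≠ 0) (α β γ : ℝ) {P : Prop}
    (hP : (∀ p ∈ slab I, fderiv ℝ V p ((α • kv1 + β • kv2 + γ • kv3) p) = 0) ↔ P) :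
    (KGLie (slab I) (diagMetric (warp F)) V (linearField (α • kv1 + β • kv2 + γ • kv3) 0) ↔ P) ∧
      (KGNoether (slab I) (diagMetric (warp F)) V
        (linearField (α • kv1 + β • kv2 + γ • kv3) 0) ↔ P) := by
  rw [← hP, kv_combination_eq,
    kgLie_diagMetric_iff (ψ := 0) (c := 0) (by norm_num) (isOpen_slab hI) (contDiffOn_warp hF)
      (warp_ne_zero hF0)
      contDiffOn_const contDiffOn_const hV (fderiv_warp_kv_combination hI hF α β γ) (by simp),
    kgNoether_diagMetric_iff (ψ := 0) (c := 0) (by norm_num) (isOpen_slab hI) (contDiffOn_warp hF)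
      (warp_ne_zero hF0) contDiffOn_const contDiffOn_const hV
      (fderiv_warp_kv_combination hI hF α β γ) (by simp)]
  simp only [diagLap_zero, Pi.zero_apply, mul_zero, zero_mul, add_zero, and_self]

/-! The metrics admitting the conformal Killing vector `X₃`. -/

def confProfile (A : ℝ → ℝ) (m l : ℝ) : Fin 4 → ℝ → ℝ :=
  ![fun t => -(A t ^ 2 * Real.exp (m * l * t)), fun t => A t ^ 2 * Real.exp (m * l * t),
    fun t => A t ^ 2 * Real.exp (m * (l - 1) * t), fun t => A t ^ 2]

theorem bianchiVConf_eq (A : ℝ → ℝ) (m l : ℝ) :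
    bianchiVConf A m l = diagMetric (warp (confProfile A m l)) := by
  funext p
  unfold bianchiVConf diagMetric
  congr 1
  funext i
  fin_cases i <;> simp [warp, warpExponent, confProfile]
  ring

theorem ckv3_combination_eq (m l α β γ : ℝ) :
    ckv3 m l + α • kv1 + β • kv2 + γ • kv3
      = affineField ![2 / m, α, β, γ] ![0, 0, 1 - α, l - α] := by
  funext p i
  fin_cases i <;> simp [affineField, ckv3, kv1, kv2, kv3] <;> ring

variable {A : ℝ → ℝ} {m l : ℝ}

theorem contDiffOn_confProfile (hA : ContDiffOn ℝ ∞ A I) (i : Fin 4) :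
    ContDiffOn ℝ ∞ (confProfile A m l i) I := by
  have h : ∀ k : ℝ, ContDiffOn ℝ ∞ (fun t => A t ^ 2 * Real.exp (k * t)) I := fun k =>
    (hA.pow 2).mul (contDiff_const.mul contDiff_id).exp.contDiffOn
  fin_cases i
  · exact (h _).neg
  · exact h _
  · exact h _
  · exact hA.pow 2

theorem confProfile_ne_zero (hA0 : ∀ t ∈ I, A t ≠ 0) (i : Fin 4) (t : ℝ) (ht : t ∈ I) :
    confProfile A m l i t ≠ 0 := by
  have h := hA0 t ht
  fin_cases i <;> simp [confProfile, h]

theorem hasDerivAt_sq_mul_exp {A' t : ℝ} (hA : HasDerivAt A A' t) (k : ℝ) :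
    HasDerivAt (fun t => A t ^ 2 * Real.exp (k * t))
      ((2 * A t * A' + k * A t ^ 2) * Real.exp (k * t)) t := by
  refine ((hA.pow 2).fun_mul (hasDerivAt_exp_mul k t)).congr_deriv ?_
  norm_num
  ring

/-- The conformal factor does not depend on `α`, `β`, `γ`, since adding Killing vectors does not
change it. -/
theorem fderiv_warp_confProfile (hI : IsOpen I) (hA : ContDiffOn ℝ ∞ A I)
    (hA0 : ∀ t ∈ I, A t ≠ 0) (hm : m ≠ 0) (α β γ : ℝ) (i : Fin 4) (p : Coord 4)
    (hp : p ∈ slab I) :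
    fderiv ℝ (warp (confProfile A m l) i) p
        (affineField ![2 / m, α, β, γ] ![0, 0, 1 - α, l - α] p)
      = 2 * (ckv3Factor A m l p - (![0, 0, 1 - α, l - α] : Fin 4 → ℝ) i)
        * warp (confProfile A m l) i p := by
  have h0 := hA0 _ hp
  have h1 := ((hA.contDiffAt (hI.mem_nhds hp)).differentiableAt (by simp)).hasDerivAt
  have h2 := hasDerivAt_sq_mul_exp h1
  match i with
  | 0 =>
    rw [fderiv_warp (F := confProfile A m l) (i := 0) (h2 (m * l)).neg]
    simp [affineField, warp, warpExponent, confProfile, ckv3Factor]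
    field_simp
  | 1 =>
    rw [fderiv_warp (F := confProfile A m l) (i := 1) (h2 (m * l))]
    simp [affineField, warp, warpExponent, confProfile, ckv3Factor]
    field_simp
  | 2 =>
    rw [fderiv_warp (F := confProfile A m l) (i := 2) (h2 (m * (l - 1)))]
    simp [affineField, warp, warpExponent, confProfile, ckv3Factor]
    field_simp
    ring
  | 3 =>
    rw [fderiv_warp (F := confProfile A m l) (i := 3) (h1.pow 2)]
    simp [affineField, warp, warpExponent, confProfile, ckv3Factor]
    field_simp
    ring

theorem isConformalKilling_ckv3 (hI : IsOpen I) (hA : ContDiffOn ℝ ∞ A I)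
    (hA0 : ∀ t ∈ I, A t ≠ 0) (hm : m ≠ 0) :
    IsConformalKilling (slab I) (bianchiVConf A m l) (ckv3 m l) (ckv3Factor A m l) := by
  intro p hp μ ν
  have e : ckv3 m l = affineField ![2 / m, 0, 0, 0] ![0, 0, 1 - 0, l - 0] := by
    rw [← ckv3_combination_eq]
    simp
  rw [bianchiVConf_eq, e, lieMetric_diagMetric,
    fderiv_warp_confProfile hI hA hA0 hm 0 0 0 μ p hp]
  split_ifs with h
  · subst h
    simp [diagMetric]
    ring
  · simp [diagMetric, h]

theorem contDiffOn_deriv (hI : IsOpen I) {f : ℝ → ℝ} (hf : ContDiffOn ℝ ∞ f I) :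
    ContDiffOn ℝ ∞ (deriv f) I :=
  hf.deriv_of_isOpen hI (by simp)

/-- `A² e^{mlt}` times `potTerm`. -/
def potSource (A : ℝ → ℝ) (m l t : ℝ) : ℝ :=
  (m * (l - 1) / 2 * deriv A t + deriv (deriv A) t) / A t

theorem hasDerivAt_of_contDiffOn (hI : IsOpen I) {f : ℝ → ℝ} (hf : ContDiffOn ℝ ∞ f I) {t : ℝ}
    (ht : t ∈ I) : HasDerivAt f (deriv f t) t :=
  ((hf.contDiffAt (hI.mem_nhds ht)).differentiableAt (by simp)).hasDerivAt

theorem hasDerivAt_potSource (hI : IsOpen I) (hA : ContDiffOn ℝ ∞ A I)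
    (hA0 : ∀ t ∈ I, A t ≠ 0) {t : ℝ} (ht : t ∈ I) :
    HasDerivAt (potSource A m l)
      (((m * (l - 1) / 2 * deriv (deriv A) t + deriv (deriv (deriv A)) t) * A t
        - (m * (l - 1) / 2 * deriv A t + deriv (deriv A) t) * deriv A t) / A t ^ 2) t := by
  have hA1 := contDiffOn_deriv hI hA
  have hA2 := contDiffOn_deriv hI hA1
  exact (((hasDerivAt_of_contDiffOn hI hA1 ht).const_mul _).fun_add
    (hasDerivAt_of_contDiffOn hI hA2 ht)).fun_div (hasDerivAt_of_contDiffOn hI hA ht) (hA0 t ht)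

/-- The product is minus a perfect square, and `A` enters the root as `A⁴`, so the sign of `A` plays
no role. -/
theorem sqrt_prod_confProfile (A : ℝ → ℝ) (m l t : ℝ) :
    Real.sqrt |∏ i, confProfile A m l i t|
      = A t ^ 4 * Real.exp (m * l * t) * Real.exp (m * (l - 1) / 2 * t) := by
  have e : ∏ i, confProfile A m l i t
      = -(A t ^ 4 * Real.exp (m * l * t) * Real.exp (m * (l - 1) / 2 * t)) ^ 2 := by
    have h : Real.exp (m * (l - 1) * t) = Real.exp (m * (l - 1) / 2 * t) ^ 2 := by
      rw [← Real.exp_nat_mul]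
      congr 1
      push_cast
      ring
    simp only [Fin.prod_univ_four, confProfile, Matrix.cons_val, h]
    ring
  rw [e, abs_neg, abs_of_nonneg (sq_nonneg _), Real.sqrt_sq (by positivity)]

/-- The Laplacian becomes an exact derivative after multiplication by `A² e^{mlt}`, because `A⁻² (A²
(A'/A)')' = (A''/A)'` and the remaining exponential in the density contributes a multiple of
`(A'/A)'`. -/
theorem diagLap_ckv3Factor (hI : IsOpen I) (hA : ContDiffOn ℝ ∞ A I)
    (hA0 : ∀ t ∈ I, A t ≠ 0) {p : Coord 4} (hp : p ∈ slab I) :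
    diagLap (warp (confProfile A m l)) (-ckv3Factor A m l) p
      = 2 / m * (A (p 0) ^ 2 * Real.exp (m * l * p 0))⁻¹ * deriv (potSource A m l) (p 0) := by
  have hA1 := contDiffOn_deriv hI hA
  have hA2 := contDiffOn_deriv hI hA1
  have d0 : ∀ t ∈ I, HasDerivAt A (deriv A t) t := fun t => hasDerivAt_of_contDiffOn hI hA
  have d1 : ∀ t ∈ I, HasDerivAt (deriv A) _ t := fun t => hasDerivAt_of_contDiffOn hI hA1
  have d2 : ∀ t ∈ I, HasDerivAt (deriv (deriv A)) _ t := fun t => hasDerivAt_of_contDiffOn hI hA2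
  have e : -ckv3Factor A m l = fun q => (fun t => -(2 / m * (deriv A t / A t) + l)) (q 0) := rfl
  have hσ : ∀ t ∈ I, A t ^ 4 * Real.exp (m * l * t) * Real.exp (m * (l - 1) / 2 * t)
      * (confProfile A m l 0 t)⁻¹ = -(A t ^ 2 * Real.exp (m * (l - 1) / 2 * t)) := by
    intro t ht
    have := hA0 t ht
    simp only [confProfile, Matrix.cons_val]
    field_simp
  rw [e, diagLap_warp hI
    (fun t ht => ((((d1 t ht).fun_div (d0 t ht) (hA0 t ht)).const_mul (2 / m)).add_const l).fun_neg)
    (fun t ht => (((((d2 t ht).fun_mul (d0 t ht)).fun_sub ((d1 t ht).fun_mul (d1 t ht))).fun_div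
      ((d0 t ht).fun_pow 2) (pow_ne_zero 2 (hA0 t ht))).const_mul (2 / m)).fun_neg)
    (fun t _ => sqrt_prod_confProfile A m l t) hσ
    (fun t ht => (hasDerivAt_sq_mul_exp (d0 t ht) (m * (l - 1) / 2)).fun_neg) hp,
    (hasDerivAt_potSource hI hA hA0 hp).deriv]
  have h0 := hA0 _ hp
  simp only [confProfile, Matrix.cons_val]
  field_simp
  ring

end Warped

/-! ### Potentials for the proper conformal fields -/

section Potentials

variable {I : Set ℝ} {V : Coord 4 → ℝ} {A : ℝ → ℝ} {m l : ℝ}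

theorem contDiffOn_ckv3Factor (hI : IsOpen I) (hA : ContDiffOn ℝ ∞ A I)
    (hA0 : ∀ t ∈ I, A t ≠ 0) : ContDiffOn ℝ ∞ (ckv3Factor A m l) (slab I) :=
  contDiffOn_comp_zero (f := fun t => 2 / m * (deriv A t / A t) + l)
    ((contDiffOn_const.mul ((contDiffOn_deriv hI hA).div hA hA0)).add contDiffOn_const)

/-- Potentials for `X₃ + αξ¹ + βξ² + γξ³`, in terms of the fixed points `y₀`, `z₀` and the rates
`k`, `q` of its flow. -/
theorem kg_ckv3_combination_iff (hI : IsOpen I) (hIc : I.OrdConnected)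
    (hV : ContDiffOn ℝ ∞ V (slab I)) (hA : ContDiffOn ℝ ∞ A I) (hA0 : ∀ t ∈ I, A t ≠ 0)
    (hm : m ≠ 0) {α β γ k y₀ q z₀ : ℝ} (hk : k = m * (α - 1) / 2) (hq : q = m * (α - l) / 2)
    (hy : β = (α - 1) * y₀) (hz : γ = (α - l) * z₀) {P : Prop}
    (hP : (∃ U : ℝ × ℝ × ℝ → ℝ, ContDiff ℝ ∞ U ∧ ∀ t ∈ I, ∀ x y z : ℝ, V ![t, x, y, z]
      = 1 / A t ^ 2 * Real.exp (-(m * l * t)) *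
          U (x - α * m / 2 * t, (y - y₀) * Real.exp (k * t), (z - z₀) * Real.exp (q * t))
        + potTerm A m l t) ↔ P) :
    (KGLie (slab I) (bianchiVConf A m l) V
        (linearField (ckv3 m l + α • kv1 + β • kv2 + γ • kv3) (-ckv3Factor A m l)) ↔ P) ∧
      (KGNoether (slab I) (bianchiVConf A m l) V
        (linearField (ckv3 m l + α • kv1 + β • kv2 + γ • kv3) (-ckv3Factor A m l)) ↔ P) := by
  have hψ := contDiffOn_ckv3Factor (m := m) (l := l) hI hA hA0
  have hc : ∀ x ∈ slab I, 2 * (-ckv3Factor A m l) x = (2 - ((4 : ℕ) : ℝ)) * ckv3Factor A m l x := by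
    intro x _
    simp only [Pi.neg_apply]
    push_cast
    ring
  rw [bianchiVConf_eq, ckv3_combination_eq,
    kgLie_diagMetric_iff (c := -ckv3Factor A m l) (by norm_num) (isOpen_slab hI)
      (contDiffOn_warp (contDiffOn_confProfile hA))
      (warp_ne_zero (confProfile_ne_zero hA0)) hψ hψ.neg hV
      (fderiv_warp_confProfile hI hA hA0 hm α β γ) hc,
    kgNoether_diagMetric_iff (c := -ckv3Factor A m l) (by norm_num) (isOpen_slab hI)
      (contDiffOn_warp (contDiffOn_confProfile hA))
      (warp_ne_zero (confProfile_ne_zero hA0)) hψ hψ.neg hV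
      (fderiv_warp_confProfile hI hA hA0 hm α β γ) hc, and_self, ← hP]
  have hw : ∀ t ∈ I, HasDerivAt (fun t => A t ^ 2 * Real.exp (m * l * t)) _ t := fun t ht =>
    hasDerivAt_sq_mul_exp (hasDerivAt_of_contDiffOn hI hA ht) (m * l)
  -- Multiplying by `m/2` times the weight `A² e^{mlt}` makes the left side `w ∂V + w' V` and the
  -- right side `v'`.
  refine Iff.trans ?_ ((weighted_fderiv_eq_iff hI hIc hV
    (w := fun t => A t ^ 2 * Real.exp (m * l * t)) (v := potSource A m l)
    (fun t ht => (hw t ht).differentiableAt.differentiableWithinAt)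
    (fun t ht => (hasDerivAt_potSource hI hA hA0 ht).differentiableAt.differentiableWithinAt)
    (α * m / 2) k y₀ q z₀).trans ?_)
  · refine forall₂_congr fun p hp => ?_
    have h0 := hA0 _ hp
    -- Dividing the field by its constant time component `2/m` makes `t` the parameter of the
    -- orbits.
    have e : affineField ![2 / m, α, β, γ] ![0, 0, 1 - α, l - α] p
        = (2 / m) • (![1, α * m / 2, -k * (p 2 - y₀), -q * (p 3 - z₀)] : Coord 4) := by
      ext i
      fin_cases i
      · simp [affineField]
      · simp [affineField]
        field_simp
      · simp [affineField, hk, hy]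
        field_simp
        ring
      · simp [affineField, hq, hz]
        field_simp
        ring
    rw [diagLap_ckv3Factor hI hA hA0 hp, e, map_smul, (hw _ hp).deriv, ckv3Factor, smul_eq_mul]
    have hE := (Real.exp_pos (m * l * p 0)).ne'
    set D := fderiv ℝ V p ![1, α * m / 2, -k * (p 2 - y₀), -q * (p 3 - z₀)]
    set E := Real.exp (m * l * p 0)
    set v := deriv (potSource A m l) (p 0)
    constructor
    · intro h
      field_simp at h
      linear_combination h
    · intro h
      field_simp
      linear_combination h
  · refine exists_congr fun U => and_congr_right fun _ => forall₂_congr fun t ht =>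
      forall₃_congr fun x y z => ?_
    have h0 := hA0 _ ht
    have hE := (Real.exp_pos (m * l * t)).ne'
    rw [potTerm, potSource, Real.exp_neg]
    set E := Real.exp (m * l * t)
    set u := U (x - α * m / 2 * t, (y - y₀) * Real.exp (k * t), (z - z₀) * Real.exp (q * t))
    constructor
    · intro h
      field_simp at h ⊢
      linear_combination h
    · intro h
      rw [h]
      field_simp
      ring

end Potentials

end KleinGordon

end

theorem mainTheorem3 (I : Set ℝ) (hI : IsOpen I) (hIc : I.OrdConnected)
    (V : KleinGordon.Coord 4 → ℝ) (hV : ContDiffOn ℝ ∞ V (KleinGordon.slab I)) :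
    (∀ N A B C : ℝ → ℝ,
      ContDiffOn ℝ ∞ N I → ContDiffOn ℝ ∞ A I → ContDiffOn ℝ ∞ B I → ContDiffOn ℝ ∞ C I →
      (∀ t ∈ I, N t ≠ 0 ∧ A t ≠ 0 ∧ B t ≠ 0 ∧ C t ≠ 0) →
      (KleinGordon.IsKilling (KleinGordon.slab I) (KleinGordon.bianchiV N A B C) KleinGordon.kv1 ∧
        KleinGordon.IsKilling (KleinGordon.slab I) (KleinGordon.bianchiV N A B C)
          KleinGordon.kv2 ∧
        KleinGordon.IsKilling (KleinGordon.slab I) (KleinGordon.bianchiV N A B C)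
          KleinGordon.kv3) ∧
      ((KleinGordon.KGLie (KleinGordon.slab I) (KleinGordon.bianchiV N A B C) V
            (KleinGordon.linearField KleinGordon.kv1 0) ↔ KleinGordon.PotI I V) ∧
        (KleinGordon.KGNoether (KleinGordon.slab I) (KleinGordon.bianchiV N A B C) V
            (KleinGordon.linearField KleinGordon.kv1 0) ↔ KleinGordon.PotI I V)) ∧
      ((KleinGordon.KGLie (KleinGordon.slab I) (KleinGordon.bianchiV N A B C) V
            (KleinGordon.linearField KleinGordon.kv2 0) ↔ KleinGordon.PotII I V) ∧
        (KleinGordon.KGNoether (KleinGordon.slab I) (KleinGordon.bianchiV N A B C) V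
            (KleinGordon.linearField KleinGordon.kv2 0) ↔ KleinGordon.PotII I V)) ∧
      ((KleinGordon.KGLie (KleinGordon.slab I) (KleinGordon.bianchiV N A B C) V
            (KleinGordon.linearField KleinGordon.kv3 0) ↔ KleinGordon.PotIII I V) ∧
        (KleinGordon.KGNoether (KleinGordon.slab I) (KleinGordon.bianchiV N A B C) V
            (KleinGordon.linearField KleinGordon.kv3 0) ↔ KleinGordon.PotIII I V)) ∧
      (∀ α β γ : ℝ, α ≠ 0 →
        (KleinGordon.KGLie (KleinGordon.slab I) (KleinGordon.bianchiV N A B C) V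
            (KleinGordon.linearField
              (α • KleinGordon.kv1 + β • KleinGordon.kv2 + γ • KleinGordon.kv3) 0)
          ↔ KleinGordon.PotIV I α β γ V) ∧
        (KleinGordon.KGNoether (KleinGordon.slab I) (KleinGordon.bianchiV N A B C) V
            (KleinGordon.linearField
              (α • KleinGordon.kv1 + β • KleinGordon.kv2 + γ • KleinGordon.kv3) 0)
          ↔ KleinGordon.PotIV I α β γ V))) ∧
    (∀ (A : ℝ → ℝ) (m l : ℝ), ContDiffOn ℝ ∞ A I → (∀ t ∈ I, A t ≠ 0) → m ≠ 0 →
      KleinGordon.IsConformalKilling (KleinGordon.slab I) (KleinGordon.bianchiVConf A m l)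
        (KleinGordon.ckv3 m l) (KleinGordon.ckv3Factor A m l) ∧
      ((KleinGordon.KGLie (KleinGordon.slab I) (KleinGordon.bianchiVConf A m l) V
            (KleinGordon.linearField (KleinGordon.ckv3 m l) (-KleinGordon.ckv3Factor A m l))
          ↔ KleinGordon.PotConf I A m l V) ∧
        (KleinGordon.KGNoether (KleinGordon.slab I) (KleinGordon.bianchiVConf A m l) V
            (KleinGordon.linearField (KleinGordon.ckv3 m l) (-KleinGordon.ckv3Factor A m l))
          ↔ KleinGordon.PotConf I A m l V)) ∧
      (∀ α β γ : ℝ, α ≠ 1 → α ≠ l →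
        (KleinGordon.KGLie (KleinGordon.slab I) (KleinGordon.bianchiVConf A m l) V
            (KleinGordon.linearField
              (KleinGordon.ckv3 m l + α • KleinGordon.kv1 + β • KleinGordon.kv2
                + γ • KleinGordon.kv3)
              (-KleinGordon.ckv3Factor A m l))
          ↔ KleinGordon.PotV I A m l α β γ V) ∧
        (KleinGordon.KGNoether (KleinGordon.slab I) (KleinGordon.bianchiVConf A m l) V
            (KleinGordon.linearField
              (KleinGordon.ckv3 m l + α • KleinGordon.kv1 + β • KleinGordon.kv2
                + γ • KleinGordon.kv3)
              (-KleinGordon.ckv3Factor A m l))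
          ↔ KleinGordon.PotV I A m l α β γ V))) := by
  refine ⟨fun N A B C hN hA hB hC h0 => ?_, fun A m l hA hA0 hm => ?_⟩
  · rw [KleinGordon.bianchiV_eq]
    have hF : ∀ i, ContDiffOn ℝ ∞ ((![fun t => -(N t) ^ 2, fun t => A t ^ 2, fun t => B t ^ 2,
        fun t => C t ^ 2] : Fin 4 → ℝ → ℝ) i) I := by
      intro i
      fin_cases i
      exacts [(hN.pow 2).neg, hA.pow 2, hB.pow 2, hC.pow 2]
    have hF0 : ∀ i, ∀ t ∈ I, (![fun t => -(N t) ^ 2, fun t => A t ^ 2, fun t => B t ^ 2,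
        fun t => C t ^ 2] : Fin 4 → ℝ → ℝ) i t ≠ 0 := by
      intro i t ht
      obtain ⟨h1, h2, h3, h4⟩ := h0 t ht
      fin_cases i <;> simp [*]
    have e1 : KleinGordon.kv1 = (1 : ℝ) • KleinGordon.kv1 + (0 : ℝ) • KleinGordon.kv2
        + (0 : ℝ) • KleinGordon.kv3 := by simp
    have e2 : KleinGordon.kv2 = (0 : ℝ) • KleinGordon.kv1 + (1 : ℝ) • KleinGordon.kv2
        + (0 : ℝ) • KleinGordon.kv3 := by simp
    have e3 : KleinGordon.kv3 = (0 : ℝ) • KleinGordon.kv1 + (0 : ℝ) • KleinGordon.kv2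
        + (1 : ℝ) • KleinGordon.kv3 := by simp
    have k := KleinGordon.isKilling_kv_combination hI hF
    have s := fun α β γ P => KleinGordon.kg_kv_combination_iff (P := P) hI hV hF hF0 α β γ
    have s1 := s 1 0 0 _ (KleinGordon.fderiv_kv_combination_eq_zero_iff hI hV one_ne_zero 0 0)
    have s2 := s 0 1 0 (KleinGordon.PotII I V)
      (by rw [← e2]; exact KleinGordon.fderiv_kv2_eq_zero_iff hI hV)
    have s3 := s 0 0 1 (KleinGordon.PotIII I V)
      (by rw [← e3]; exact KleinGordon.fderiv_kv3_eq_zero_iff hI hV)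
    rw [← e1, ← KleinGordon.potI_iff] at s1
    rw [← e2] at s2
    rw [← e3] at s3
    refine ⟨⟨?_, ?_, ?_⟩, s1, s2, s3, fun α β γ hα =>
      s α β γ _ (KleinGordon.fderiv_kv_combination_eq_zero_iff hI hV hα β γ)⟩
    · rw [e1]
      exact k 1 0 0
    · rw [e2]
      exact k 0 1 0
    · rw [e3]
      exact k 0 0 1
  · refine ⟨KleinGordon.isConformalKilling_ckv3 hI hA hA0 hm, ?_, fun α β γ h1 hl => ?_⟩
    · have h := KleinGordon.kg_ckv3_combination_iff (m := m) (l := l) (α := 0) (β := 0) (γ := 0)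
        (y₀ := 0) (z₀ := 0) (P := KleinGordon.PotConf I A m l V) hI hIc hV hA hA0 hm rfl rfl
        (by simp) (by simp) (by
          have a1 : ∀ t, m * (0 - 1) / 2 * t = -(m / 2 * t) := fun t => by ring
          have a2 : ∀ t, m * (0 - l) / 2 * t = -(m * l / 2 * t) := fun t => by ring
          simp only [KleinGordon.PotConf, a1, a2, sub_zero, zero_mul, zero_div])
      simpa only [zero_smul, add_zero] using h
    · have h1' : α - 1 ≠ 0 := sub_ne_zero.2 h1
      have hl' : α - l ≠ 0 := sub_ne_zero.2 hl
      exact KleinGordon.kg_ckv3_combination_iff hI hIc hV hA hA0 hm rfl rfl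
        (by field_simp) (by field_simp) Iff.rfl
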